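/- For finite $A\subset\mathbb{R}^d$ and $r\neq 0$ let $\operatorname{dirW}(A,r)=\sup_{s,v\in A}\langle r/\|r\|,s-v\rangle$. Let $\operatorname{width}(A)$ be the infimum of $\operatorname{dirW}(A,r)$ over all nonzero directions $r$ of the affine hull of $A$, and let $\operatorname{minwidth}(A)$ be the minimum of $\operatorname{width}(B)$ over all subsets $B\subseteq A$ with at least two points. For a direction $r\ne 0$ and a point $x\in\operatorname{conv}(A)$ let \[ \operatorname{PDirW}(A,r,x)=\min_{T}\ \max_{s\in A,\,v\in T}\Big\langle \frac{r}{\|r\|},s-v\Big\rangle , \] where $T$ ranges over the subsets of $A$ such that $x$ is a convex combination of the elements of $T$ with all weights positive, and let \[ \operatorname{PWidth}(A)=\min_{\substack{K\in\operatorname{faces}(\operatorname{conv}A),\ x\in K\\ r\in\operatorname{cone}(K-x)\setminus\{0\}}}\operatorname{PDirW}(K\cap A,r,x). \] For a polytope $C$ of dimension at least $1$ let \[ \Phi(C)=\min_{\substack{F\in\operatorname{faces}(C)\\ \emptyset\subsetneq F\subsetneq C}}\operatorname{dist}\big(F,\operatorname{conv}(\operatorname{vertices}(C)\setminus F)\big),\qquad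 \operatorname{vf}(C)=\min_{F\in\operatorname{facets}(C)}\operatorname{dist}\big(\operatorname{aff}F,\operatorname{vertices}(C)\setminus F\big). \] There is a sequence $\varepsilon_d\to 0$ such that for every $d\ge 1$ there are $d+1$ vectors in $\{0,1\}^d$ that form the vertices of a $d$-dimensional simplex $S\subset\mathbb{R}^d$ with \[ \operatorname{width}(\operatorname{vertices}(S))=\operatorname{minwidth}(\operatorname{vertices}(S))\le\operatorname{PWidth}(\operatorname{vertices}(S))=\Phi(S)\le\operatorname{vf}(S)\le\frac{2^{d(2+\varepsilon_d)}}{d^{d/2}} . \] -/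

import Mathlib

open Filter Topology

namespace PolytopeConditioning

noncomputable section

/- All measures take values in the extended reals, so that an infimum over the empty family is `⊤`
   and never a spurious real number. -/

variable {E : Type*} [NormedAddCommGroup E] [InnerProductSpace ℝ E]

/-- Directional width of `A` with respect to the direction `r`:
the supremum of `⟨r / ‖r‖, s - v⟩` over `s, v ∈ A`. -/
def dirWidth (A : Set E) (r : E) : EReal :=
  ⨆ s ∈ A, ⨆ v ∈ A, ((inner ℝ (‖r‖⁻¹ • r) (s - v) : ℝ) : EReal)

/-- Width of `A`: the infimum of the directional widths over all directions (nonzero vectors)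
of the affine hull of `A`. A set with at most one point has no direction and hence width `⊤`. -/
def width (A : Set E) : EReal :=
  ⨅ r ∈ {r : E | r ∈ (affineSpan ℝ A).direction ∧ r ≠ 0}, dirWidth A r

/-- The smallest width of a subset of `A`. Subsets with at most one point, which have no
direction, do not contribute, as their width is `⊤`. -/
def minWidth (A : Set E) : EReal :=
  ⨅ B ∈ {B : Set E | B ⊆ A}, width B

/-- `x` is a proper convex combination (all weights positive) of all the elements of `T`. -/
def IsProperConvexCombination (x : E) (T : Finset E) : Prop :=
  ∃ w : E → ℝ, (∀ v ∈ T, 0 < w v) ∧ ∑ v ∈ T, w v = 1 ∧ ∑ v ∈ T, w v • v = x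

/-- Pyramidal directional width of `A` with respect to the direction `r` and base point `x`. -/
def pyramidalDirWidth (A : Set E) (r x : E) : EReal :=
  ⨅ T ∈ {T : Finset E | (T : Set E) ⊆ A ∧ IsProperConvexCombination x T},
    ⨆ s ∈ A, ⨆ v ∈ T, ((inner ℝ (‖r‖⁻¹ • r) (s - v) : ℝ) : EReal)

/-- Faces of a polytope `C`: the sets of maximizers over `C` of linear functionals, and the empty
set; `C` itself is a face. -/
def faces (C : Set E) : Set (Set E) := {F | IsExposed ℝ C F}

/-- The vertices of a polytope. -/
def vertices (C : Set E) : Set E := C.extremePoints ℝ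

/-- Facets of a polytope `C` with `dim C ≥ 1`: the nonempty faces of dimension `dim C - 1`. -/
def facets (C : Set E) : Set (Set E) :=
  {F | F ∈ faces C ∧ F.Nonempty ∧
    Module.finrank ℝ (affineSpan ℝ F).direction + 1 =
      Module.finrank ℝ (affineSpan ℝ C).direction}

/-- Pyramidal width of `A`: the smallest pyramidal directional width over all faces `K` of the
convex hull of `A`, base points `x ∈ K` and nonzero directions `r` in the convex cone generated
by `K - x`. -/
def pyramidalWidth (A : Set E) : EReal :=
  ⨅ K ∈ faces (convexHull ℝ A), ⨅ x ∈ K,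
    ⨅ r ∈ {r : E | r ∈ PointedCone.hull ℝ ((fun y => y - x) '' K) ∧ r ≠ 0},
      pyramidalDirWidth (K ∩ A) r x

/-- Distance between two sets. -/
def setDist (X Y : Set E) : EReal :=
  ⨅ x ∈ X, ⨅ y ∈ Y, ((dist x y : ℝ) : EReal)

/-- Facial distance of a polytope `C`. -/
def facialDist (C : Set E) : EReal :=
  ⨅ F ∈ {F : Set E | F ∈ faces C ∧ F.Nonempty ∧ F ⊂ C},
    setDist F (convexHull ℝ (vertices C \ F))

/-- Vertex-facet distance of a polytope `P`. -/
def vertexFacetDist (P : Set E) : EReal :=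
  ⨅ F ∈ facets P, setDist (affineSpan ℝ F : Set E) (vertices P \ F)

end

end PolytopeConditioning

open PolytopeConditioning

/-! The chain of relations up to `vertexFacetDist` holds for every full-dimensional simplex; only
the last bound needs a special one.

For a vector `u ≠ 0` let `c i` be the linear parts of the barycentric coordinates at `u`. They sum
to zero, so with `N` the sum of the positive ones, `u / N` is a difference of a point of the face
spanned by `{c i > 0}` and a point of the hull of the other vertices. Hence the facial distance is
at most `‖u‖ / N` (`facialDist_le_norm_div`), and suitable choices of `u` bound it by the pyramidal
width and by the vertex-facet distance. Conversely, at a closest pair `x, y` of opposite faces, `⟨x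
- y, ·⟩` is constant on the vertices carrying `x` and on those carrying `y`
(`exists_closest_points`), so the width of these vertices in direction `x - y` is at most `dist x
y`. This bounds `minWidth` and `pyramidalWidth` by the facial distance. That `width` equals
`minWidth` follows from an affine retraction of all vertices into a given subset of them
(`width_le_width_of_subset_range`).

For the numerical bound, take the simplex on `0` and the columns of an invertible 0/1 matrix `M`. An
entry `y s` of the inverse puts a vertex at distance at most `1 / |y s|` from its opposite facet
hyperplane (`exists_zeroOne_simplex`), so an ill-conditioned `M` is needed. For size `2 ^ m` it is
built in the manner of Håstad and of Alon and Vu: the subsets of `range m` with at least three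
elements form a chain, and each `a` in it has a row, a combination of Walsh characters taking only
the values `1` and `-1`, whose equation makes the Walsh transform of the solution grow by a factor
at least `2 ^ |a| / 2 - 2` (`exists_isStep`, `chain_growth`). The product of these factors is about
`n ^ (n / 2) / 2 ^ n` for `n = 2 ^ m`. Other sizes are glued from powers of two by block triangular
matrices, which multiply the large entries (`HasLargeInverseEntry.sum`); the gluing costs the second
factor `2 ^ d`. -/

namespace PolytopeConditioning

/-! ### Barycentric coordinates and faces of a simplex -/

section Simplex

variable {ι E : Type*} [NormedAddCommGroup E] [InnerProductSpace ℝ E] (b : AffineBasis ι ℝ E)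

theorem coord_linear_sub (i : ι) (x y : E) :
    (b.coord i).linear (x - y) = b.coord i x - b.coord i y := by
  simpa using (b.coord i).linearMap_vsub x y

theorem mem_convexHull_range_iff (x : E) :
    x ∈ convexHull ℝ (Set.range b) ↔ ∀ i, 0 ≤ b.coord i x := by
  rw [b.convexHull_eq_nonneg_coord]; rfl

variable [Fintype ι]

theorem sum_coord_linear (u : E) : ∑ i, (b.coord i).linear u = 0 := by
  have h : ∀ i, (b.coord i).linear u = b.coord i u - b.coord i 0 := fun i => by
    rw [← coord_linear_sub, sub_zero]
  simp only [h, Finset.sum_sub_distrib, b.sum_coord_apply_eq_one, sub_self]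

theorem sum_coord_linear_smul (u : E) : ∑ i, (b.coord i).linear u • b i = u := by
  have h : ∀ i, (b.coord i).linear u = b.coord i u - b.coord i 0 := fun i => by
    rw [← coord_linear_sub, sub_zero]
  simp only [h, sub_smul, Finset.sum_sub_distrib, b.linear_combination_coord_eq_self, sub_zero]

theorem mem_convexHull_image_iff (I : Set ι) (x : E) :
    x ∈ convexHull ℝ (b '' I) ↔ (∀ i, 0 ≤ b.coord i x) ∧ ∀ i, i ∉ I → b.coord i x = 0 := by
  classical
  constructor
  · intro hx
    have hconv : Convex ℝ {x | (∀ i, 0 ≤ b.coord i x) ∧ ∀ i, i ∉ I → b.coord i x = 0} := by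
      intro x hx y hy s t hs ht hst
      have h : ∀ i, b.coord i (s • x + t • y) = s * b.coord i x + t * b.coord i y := fun i => by
        simpa using Convex.combo_affine_apply (f := b.coord i) hst
      refine ⟨fun i => ?_, fun i hi => ?_⟩
      · rw [h]
        exact add_nonneg (mul_nonneg hs (hx.1 i)) (mul_nonneg ht (hy.1 i))
      · rw [h, hx.2 i hi, hy.2 i hi]; simp
    refine convexHull_min ?_ hconv hx
    rintro _ ⟨j, hj, rfl⟩
    refine ⟨fun i => ?_, fun i hi => ?_⟩
    · rw [b.coord_apply]; split_ifs <;> norm_num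
    · rw [b.coord_apply_ne]; rintro rfl; exact hi hj
  · rintro ⟨h0, hI⟩
    rw [← b.linear_combination_coord_eq_self x]
    have hs : ∑ i, b.coord i x • b i = ∑ i with i ∈ I, b.coord i x • b i := by
      rw [Finset.sum_filter_of_ne]
      intro i _ hi
      by_contra h
      exact hi (by rw [hI i h, zero_smul])
    have h1 : ∑ i with i ∈ I, b.coord i x = 1 := by
      rw [Finset.sum_filter_of_ne, b.sum_coord_apply_eq_one]
      intro i _ hi
      by_contra h
      exact hi (hI i h)
    rw [hs]
    refine (convex_convexHull ℝ _).sum_mem (fun i _ => h0 i) h1 fun i hi => ?_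
    exact subset_convexHull ℝ _ ⟨i, (Finset.mem_filter.1 hi).2, rfl⟩

theorem apply_mem_convexHull_image_iff (I : Set ι) (i : ι) :
    b i ∈ convexHull ℝ (b '' I) ↔ i ∈ I := by
  refine ⟨fun h => ?_, fun h => subset_convexHull ℝ _ ⟨i, h, rfl⟩⟩
  by_contra hi
  have := ((mem_convexHull_image_iff b I _).1 h).2 i hi
  rw [b.coord_apply_eq] at this
  exact one_ne_zero this

/-- A functional attaining its maximum at `x` averages its vertex values with the coordinates of `x`
as weights, so every vertex of positive weight attains the maximum too. -/
theorem apply_mem_of_mem_faces {K : Set E} (hK : K ∈ faces (convexHull ℝ (Set.range b))) {x : E}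
    (hx : x ∈ K) {i : ι} (hi : 0 < b.coord i x) : b i ∈ K := by
  obtain ⟨l, hl⟩ := hK ⟨x, hx⟩
  have hbi : ∀ j, b j ∈ convexHull ℝ (Set.range b) := fun j => subset_convexHull ℝ _ ⟨j, rfl⟩
  have hx' := hx
  rw [hl] at hx' ⊢
  obtain ⟨hxS, hmax⟩ := hx'
  have h0 := (mem_convexHull_range_iff b x).1 hxS
  refine ⟨hbi i, fun y hy => (hmax y hy).trans ?_⟩
  have hsum : ∑ j, b.coord j x * (l x - l (b j)) = 0 := by
    have h1 := congrArg l (b.linear_combination_coord_eq_self x)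
    simp only [map_sum, map_smul, smul_eq_mul] at h1
    simp only [mul_sub, Finset.sum_sub_distrib, ← Finset.sum_mul, b.sum_coord_apply_eq_one]
    rw [h1]; ring
  have h2 := (Finset.sum_eq_zero_iff_of_nonneg fun j _ =>
    mul_nonneg (h0 j) (sub_nonneg.2 (hmax _ (hbi j)))).1 hsum i (Finset.mem_univ i)
  rcases mul_eq_zero.1 h2 with h | h
  · exact absurd h hi.ne'
  · linarith

theorem vertices_convexHull_range : vertices (convexHull ℝ (Set.range b)) = Set.range b := by
  refine extremePoints_convexHull_subset.antisymm ?_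
  rintro _ ⟨i, rfl⟩
  refine mem_extremePoints.2 ⟨subset_convexHull ℝ _ ⟨i, rfl⟩, ?_⟩
  have key : ∀ x ∈ convexHull ℝ (Set.range b), ∀ y ∈ convexHull ℝ (Set.range b),
      b i ∈ openSegment ℝ x y → x = b i := by
    rintro x hx y hy ⟨s, t, hs, ht, hst, h⟩
    have hx0 := (mem_convexHull_range_iff b x).1 hx
    have hy0 := (mem_convexHull_range_iff b y).1 hy
    have hz : ∀ j, j ≠ i → b.coord j x = 0 := fun j hj => by
      have h1 : b.coord j (s • x + t • y) = s * b.coord j x + t * b.coord j y := by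
        simpa using Convex.combo_affine_apply (f := b.coord j) hst
      rw [h, b.coord_apply_ne hj] at h1
      have h2 := mul_nonneg ht.le (hy0 j)
      have h3 := mul_nonneg hs.le (hx0 j)
      exact (mul_eq_zero.1 (by linarith : s * b.coord j x = 0)).resolve_left hs.ne'
    have h1 : b.coord i x = 1 := by
      rw [← b.sum_coord_apply_eq_one x]
      exact (Finset.sum_eq_single i (fun j _ hj => hz j hj) (by simp)).symm
    rw [← b.linear_combination_coord_eq_self x,
      Finset.sum_eq_single i (fun j _ hj => by rw [hz j hj, zero_smul]) (by simp), h1, one_smul]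
  intro x hx y hy h
  exact ⟨key x hx y hy h, key y hy x hx (openSegment_symm ℝ x y ▸ h)⟩

variable [FiniteDimensional ℝ E]

/-- The sum of the coordinates in `I` is at most `1` on the simplex and equals `1` exactly where the
other coordinates vanish, so its linear part exposes this face. -/
theorem convexHull_image_mem_faces (I : Set ι) :
    convexHull ℝ (b '' I) ∈ faces (convexHull ℝ (Set.range b)) := by
  classical
  rintro ⟨x₀, hx₀⟩
  let f : E →ᵃ[ℝ] ℝ := ∑ i with i ∈ I, b.coord i
  have hf : ∀ x, f x = ∑ i with i ∈ I, b.coord i x := fun x => by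
    simp only [f]
    generalize (Finset.univ.filter (· ∈ I)) = s
    induction s using Finset.induction_on with
    | empty => simp
    | insert a s ha ih => simp [Finset.sum_insert ha, ih]
  have hle : ∀ x ∈ convexHull ℝ (Set.range b), f x ≤ 1 := fun x hx => by
    rw [hf, ← b.sum_coord_apply_eq_one x]
    exact Finset.sum_le_sum_of_subset_of_nonneg (Finset.filter_subset _ _)
      fun i _ _ => (mem_convexHull_range_iff b x).1 hx i
  have heq : ∀ x ∈ convexHull ℝ (b '' I), f x = 1 := fun x hx => by
    rw [hf, Finset.sum_filter_of_ne, b.sum_coord_apply_eq_one]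
    intro i _ hi
    by_contra h
    exact hi (((mem_convexHull_image_iff b I x).1 hx).2 i h)
  have hlf : ∀ x y, f.linear x ≤ f.linear y ↔ f x ≤ f y := fun x y => by
    have h := f.linearMap_vsub x y
    simp only [vsub_eq_sub, map_sub] at h
    constructor <;> intro _ <;> linarith
  have hsub : convexHull ℝ (b '' I) ⊆ convexHull ℝ (Set.range b) :=
    convexHull_mono (Set.image_subset_range _ _)
  refine ⟨LinearMap.toContinuousLinearMap f.linear, ?_⟩
  ext x
  simp only [LinearMap.coe_toContinuousLinearMap', Set.mem_ofPred_eq, hlf]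
  constructor
  · intro hx
    exact ⟨hsub hx, fun y hy => by rw [heq x hx]; exact hle y hy⟩
  · rintro ⟨hx, hmax⟩
    have h0 := (mem_convexHull_range_iff b x).1 hx
    refine (mem_convexHull_image_iff b I x).2 ⟨h0, fun i hi => ?_⟩
    have h1 : f x = 1 := le_antisymm (hle x hx) (by rw [← heq x₀ hx₀]; exact hmax x₀ (hsub hx₀))
    have h2 := Finset.sum_filter_add_sum_filter_not Finset.univ (· ∈ I) fun i => b.coord i x
    rw [← hf, h1, b.sum_coord_apply_eq_one] at h2
    have h3 : ∑ i with i ∉ I, b.coord i x = 0 := by linarith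
    exact (Finset.sum_eq_zero_iff_of_nonneg fun i _ => h0 i).1 h3 i (by simp [hi])

/-- Affine independence lets vertex values be prescribed freely, and Riesz representation turns the
resulting functional into a vector. -/
theorem exists_inner_eq (g : ι → ℝ) : ∃ r : E, ∀ i j, inner ℝ r (b i - b j) = g i - g j := by
  classical
  let L : E →ₗ[ℝ] ℝ := ∑ i, g i • (b.coord i).linear
  refine ⟨(InnerProductSpace.toDual ℝ E).symm (LinearMap.toContinuousLinearMap L), fun i j => ?_⟩
  rw [InnerProductSpace.toDual_symm_apply]
  simp only [LinearMap.coe_toContinuousLinearMap', L, LinearMap.sum_apply, LinearMap.smul_apply,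
    coord_linear_sub, b.coord_apply, smul_eq_mul, mul_sub, Finset.sum_sub_distrib]
  simp

end Simplex

/-! ### Upper bounds for the facial distance -/

section Simplex

variable {ι E : Type*} [Fintype ι] [NormedAddCommGroup E] [InnerProductSpace ℝ E]
  (b : AffineBasis ι ℝ E)

theorem coord_sum_smul (w : ι → ℝ) (hw : ∑ i, w i = 1) (i : ι) :
    b.coord i (∑ j, w j • b j) = w i := by
  rw [← Finset.affineCombination_eq_linear_combination _ _ _ hw,
    b.coord_apply_combination_of_mem (Finset.mem_univ i) hw]

theorem vertices_sdiff (F : Set E) :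
    vertices (convexHull ℝ (Set.range b)) \ F = b '' {i | b i ∉ F} := by
  rw [vertices_convexHull_range]
  ext x
  constructor
  · rintro ⟨⟨i, rfl⟩, h⟩
    exact ⟨i, h, rfl⟩
  · rintro ⟨i, h, rfl⟩
    exact ⟨⟨i, rfl⟩, h⟩

theorem exists_coord_linear_pos {u : E} (hu : u ≠ 0) : ∃ i, 0 < (b.coord i).linear u := by
  by_contra! h
  have h1 := (Finset.sum_eq_zero_iff_of_nonpos fun i _ => h i).1 (sum_coord_linear b u)
  apply hu
  rw [← sum_coord_linear_smul b u]
  exact Finset.sum_eq_zero fun i hi => by rw [h1 i hi, zero_smul]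

theorem exists_coord_linear_neg {u : E} (hu : u ≠ 0) : ∃ i, (b.coord i).linear u < 0 := by
  obtain ⟨i, hi⟩ := exists_coord_linear_pos b (neg_ne_zero.2 hu)
  exact ⟨i, by simpa only [map_neg, Left.neg_pos_iff] using hi⟩

theorem sum_max_coord_linear_pos {u : E} (hu : u ≠ 0) :
    0 < ∑ i, max ((b.coord i).linear u) 0 := by
  obtain ⟨i, hi⟩ := exists_coord_linear_pos b hu
  exact Finset.sum_pos' (fun _ _ => le_max_right _ _) ⟨i, Finset.mem_univ i, lt_max_of_lt_left hi⟩

theorem sum_max_neg_coord_linear (u : E) :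
    ∑ i, max (-(b.coord i).linear u) 0 = ∑ i, max ((b.coord i).linear u) 0 := by
  rw [eq_comm, ← sub_eq_zero, ← Finset.sum_sub_distrib]
  simp only [max_zero_sub_max_neg_zero_eq_self, sum_coord_linear]

/-- Splitting the coordinates of `u` by sign and normalizing both parts by their common total writes
`u / N` as `z - w`, with `z` and `w` in opposite faces. Both signs occur, so the face of `z` is
nonempty and proper. -/
theorem facialDist_le_norm_div [FiniteDimensional ℝ E] {u : E} (hu : u ≠ 0) :
    facialDist (convexHull ℝ (Set.range b)) ≤
      ((‖u‖ / ∑ i, max ((b.coord i).linear u) 0 : ℝ) : EReal) := by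
  classical
  set c : ι → ℝ := fun i => (b.coord i).linear u with hc
  change _ ≤ ((‖u‖ / ∑ i, max (c i) 0 : ℝ) : EReal)
  set N := ∑ i, max (c i) 0 with hN
  have hNpos : 0 < N := sum_max_coord_linear_pos b hu
  obtain ⟨i₀, hi₀⟩ := exists_coord_linear_neg b hu
  obtain ⟨i₁, hi₁⟩ := exists_coord_linear_pos b hu
  set I : Set ι := {i | 0 < c i} with hI
  set z := ∑ i, (max (c i) 0 / N) • b i with hz
  set w := ∑ i, (max (-c i) 0 / N) • b i with hw
  have hzs : ∑ i, max (c i) 0 / N = 1 := by rw [← Finset.sum_div, div_self hNpos.ne']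
  have hws : ∑ i, max (-c i) 0 / N = 1 := by
    rw [← Finset.sum_div, sum_max_neg_coord_linear, div_self hNpos.ne']
  have hzF : z ∈ convexHull ℝ (b '' I) := by
    refine (mem_convexHull_image_iff b I z).2 ⟨fun i => ?_, fun i hi => ?_⟩
    · rw [hz, coord_sum_smul b (fun i => max (c i) 0 / N) hzs]
      exact div_nonneg (le_max_right _ _) hNpos.le
    · rw [hz, coord_sum_smul b (fun i => max (c i) 0 / N) hzs, max_eq_right (not_lt.1 hi), zero_div]
  have hverts : vertices (convexHull ℝ (Set.range b)) \ convexHull ℝ (b '' I) = b '' Iᶜ := by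
    rw [vertices_sdiff]
    congr 1
    ext i
    simp only [Set.mem_ofPred_eq, apply_mem_convexHull_image_iff, Set.mem_compl_iff]
  have hwF : w ∈ convexHull ℝ (b '' Iᶜ) := by
    refine (mem_convexHull_image_iff b Iᶜ w).2 ⟨fun i => ?_, fun i hi => ?_⟩
    · rw [hw, coord_sum_smul b (fun i => max (-c i) 0 / N) hws]
      exact div_nonneg (le_max_right _ _) hNpos.le
    · rw [hw, coord_sum_smul b (fun i => max (-c i) 0 / N) hws, max_eq_right, zero_div]
      exact neg_nonpos.2 (not_not.1 hi : 0 < c i).le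
  have hdist : dist z w = ‖u‖ / N := by
    have h : z - w = N⁻¹ • u := by
      rw [← sum_coord_linear_smul b u, hz, hw, ← Finset.sum_sub_distrib, Finset.smul_sum]
      refine Finset.sum_congr rfl fun i _ => ?_
      rw [← sub_smul, smul_smul, ← sub_div, max_zero_sub_max_neg_zero_eq_self, inv_mul_eq_div]
    rw [dist_eq_norm, h, norm_smul, norm_inv, Real.norm_of_nonneg hNpos.le, inv_mul_eq_div]
  have hmem : convexHull ℝ (b '' I) ∈ {F | F ∈ faces (convexHull ℝ (Set.range b)) ∧ F.Nonempty ∧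
      F ⊂ convexHull ℝ (Set.range b)} := by
    refine ⟨convexHull_image_mem_faces b I, ⟨z, hzF⟩,
      convexHull_mono (Set.image_subset_range _ _), fun h => ?_⟩
    have := (apply_mem_convexHull_image_iff b I i₀).1 (h (subset_convexHull ℝ _ ⟨i₀, rfl⟩))
    exact lt_asymm hi₀ this
  refine (iInf₂_le _ hmem).trans ?_
  rw [hverts, ← hdist]
  exact (iInf₂_le z hzF).trans (iInf₂_le w hwF)

theorem facialDist_le_pyramidalWidth [FiniteDimensional ℝ E] :
    facialDist (convexHull ℝ (Set.range b)) ≤ pyramidalWidth (Set.range b) := by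
  refine le_iInf₂ fun K hK => le_iInf₂ fun x hx => le_iInf₂ fun r hr => le_iInf₂ fun T hT => ?_
  obtain ⟨hrcone, hr0⟩ := hr
  obtain ⟨hTK, w, hw0, hw1, hwx⟩ := hT
  -- Barycentric coordinates are unique, so every admissible `T` contains all vertices carrying `x`.
  have hxT : ∀ i, b.coord i x ≠ 0 → b i ∈ T := fun i hi => by
    classical
    by_contra hiT
    apply hi
    have hTb : T = (Finset.univ.filter fun j => b j ∈ T).image b := by
      ext v
      simp only [Finset.mem_image, Finset.mem_filter, Finset.mem_univ, true_and]
      refine ⟨fun hv => ?_, ?_⟩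
      · obtain ⟨j, rfl⟩ := (hTK hv).2
        exact ⟨j, hv, rfl⟩
      · rintro ⟨j, hj, rfl⟩
        exact hj
    set w' : ι → ℝ := fun j => if b j ∈ T then w (b j) else 0 with hw'
    have h1 : ∑ j, w' j = 1 := by
      rw [← hw1, hTb, Finset.sum_image fun _ _ _ _ h => b.ind.injective h, Finset.sum_filter]
    have h2 : ∑ j, w' j • b j = x := by
      rw [← hwx, hTb, Finset.sum_image fun _ _ _ _ h => b.ind.injective h, Finset.sum_filter]
      exact Finset.sum_congr rfl fun j _ => by simp only [hw']; split_ifs <;> simp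
    rw [← h2, coord_sum_smul b _ h1]
    exact if_neg hiT
  -- On a generator `k - x`, a coordinate can be negative only where `x` has weight and positive
  -- only where `k` has; both implications survive sums and nonnegative multiples.
  have hsign : ∀ i, ((b.coord i).linear r < 0 → b i ∈ T) ∧ (0 < (b.coord i).linear r → b i ∈ K) := by
    intro i
    refine Submodule.span_induction
      (p := fun u _ => ((b.coord i).linear u < 0 → b i ∈ T) ∧ (0 < (b.coord i).linear u → b i ∈ K))
      ?_ (by simp) ?_ ?_ hrcone
    · rintro _ ⟨k, hk, rfl⟩
      have hS : ∀ y ∈ K, 0 ≤ b.coord i y := fun y hy => by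
        have hsub : K ⊆ convexHull ℝ (Set.range b) := IsExposed.subset hK
        exact (mem_convexHull_range_iff b y).1 (hsub hy) i
      rw [coord_linear_sub]
      have h1 := hS x hx
      have h2 := hS k hk
      exact ⟨fun h => hxT i (by linarith : 0 < b.coord i x).ne',
        fun h => apply_mem_of_mem_faces b hK hk (by linarith)⟩
    · intro u v _ _ hu hv
      rw [map_add]
      refine ⟨fun h => ?_, fun h => ?_⟩
      · rcases lt_or_ge ((b.coord i).linear u) 0 with h1 | h1
        · exact hu.1 h1
        · exact hv.1 (by linarith)
      · rcases lt_or_ge 0 ((b.coord i).linear u) with h1 | h1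
        · exact hu.2 h1
        · exact hv.2 (by linarith)
    · intro a u _ hu
      have ha : (0 : ℝ) ≤ (a : ℝ) := a.2
      have h0 : (b.coord i).linear (a • u) = (a : ℝ) * (b.coord i).linear u := by
        exact map_smul (b.coord i).linear (a : ℝ) u
      rw [h0]
      refine ⟨fun h => hu.1 ?_, fun h => hu.2 ?_⟩
      · by_contra! h1
        exact absurd (mul_nonneg ha h1) (not_le.2 h)
      · by_contra! h1
        exact absurd (mul_nonpos_of_nonneg_of_nonpos ha h1) (not_le.2 h)
  set c : ι → ℝ := fun i => (b.coord i).linear r with hc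
  classical
  obtain ⟨s, hs, hsmax⟩ := Finset.exists_max_image (Finset.univ.filter fun i => 0 < c i)
    (fun i => inner ℝ r (b i)) (by
      obtain ⟨i, hi⟩ := exists_coord_linear_pos b hr0
      exact ⟨i, Finset.mem_filter.2 ⟨Finset.mem_univ i, hi⟩⟩)
  obtain ⟨v, hv, hvmin⟩ := Finset.exists_min_image (Finset.univ.filter fun i => c i < 0)
    (fun i => inner ℝ r (b i)) (by
      obtain ⟨i, hi⟩ := exists_coord_linear_neg b hr0
      exact ⟨i, Finset.mem_filter.2 ⟨Finset.mem_univ i, hi⟩⟩)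
  simp only [Finset.mem_filter, Finset.mem_univ, true_and] at hs hsmax hv hvmin
  have hNpos := sum_max_coord_linear_pos b hr0
  set N := ∑ i, max (c i) 0 with hN
  -- Expand `⟨r, r⟩ = ∑ c i * ⟨r, b i⟩`, replacing the value by its maximum `b s` where `c i > 0`
  -- and by its minimum `b v` where `c i < 0`.
  have hineq : ‖r‖ ^ 2 ≤ N * inner ℝ r (b s - b v) := by
    have h1 : ‖r‖ ^ 2 = ∑ i, c i * inner ℝ r (b i) := by
      rw [← real_inner_self_eq_norm_sq]
      conv_lhs => rw [← sum_coord_linear_smul b r]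
      rw [sum_coord_linear_smul b r]
      nth_rewrite 2 [← sum_coord_linear_smul b r]
      rw [inner_sum]
      simp only [real_inner_smul_right, hc]
    have h2 : N * inner ℝ r (b s - b v) =
        ∑ i, (max (c i) 0 * inner ℝ r (b s) - max (-c i) 0 * inner ℝ r (b v)) := by
      rw [Finset.sum_sub_distrib, ← Finset.sum_mul, ← Finset.sum_mul, sum_max_neg_coord_linear,
        inner_sub_right, mul_sub]
    rw [h1, h2]
    refine Finset.sum_le_sum fun i _ => ?_
    rcases lt_trichotomy (c i) 0 with h | h | h
    · rw [max_eq_right h.le, max_eq_left (neg_nonneg.2 h.le)]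
      nlinarith [hvmin i h]
    · simp [h]
    · rw [max_eq_left h.le, max_eq_right (neg_nonpos.2 h.le)]
      nlinarith [hsmax i h]
  have hrpos : 0 < ‖r‖ := norm_pos_iff.2 hr0
  refine (facialDist_le_norm_div b hr0).trans ?_
  refine le_trans ?_ (le_iSup₂_of_le (b s) ⟨(hsign s).2 hs, s, rfl⟩
    (le_iSup₂_of_le (b v) ((hsign v).1 hv) le_rfl))
  rw [EReal.coe_le_coe_iff, real_inner_smul_left]
  change ‖r‖ / N ≤ _
  rw [div_le_iff₀ hNpos, ← mul_le_mul_iff_right₀ hrpos]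
  calc ‖r‖ * ‖r‖ = ‖r‖ ^ 2 := by ring
    _ ≤ _ := hineq
    _ = _ := by field_simp

theorem facialDist_le_vertexFacetDist [FiniteDimensional ℝ E] :
    facialDist (convexHull ℝ (Set.range b)) ≤ vertexFacetDist (convexHull ℝ (Set.range b)) := by
  refine le_iInf₂ fun F hF => le_iInf₂ fun p hp => le_iInf₂ fun v hv => ?_
  rw [vertices_sdiff] at hv
  obtain ⟨i, hi, rfl⟩ := hv
  have hcoord : b.coord i p = 0 := by
    have hle : affineSpan ℝ F ≤ AffineSubspace.comap (b.coord i) (affineSpan ℝ {(0 : ℝ)}) := by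
      refine affineSpan_le.2 fun x hx => ?_
      simp only [AffineSubspace.coe_comap, Set.mem_preimage, AffineSubspace.coe_affineSpan_singleton,
        Set.mem_singleton_iff]
      by_contra hne
      have h0 := (mem_convexHull_range_iff b x).1 (IsExposed.subset hF.1 hx) i
      exact hi (apply_mem_of_mem_faces b hF.1 hx (lt_of_le_of_ne h0 (Ne.symm hne)))
    simpa using hle hp
  -- The point `p` lies where coordinate `i` vanishes, so the normalizing sum for `u = b i - p` is
  -- at least `1`.
  have hone : (b.coord i).linear (b i - p) = 1 := by
    rw [coord_linear_sub, b.coord_apply_eq, hcoord, sub_zero]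
  have hu : b i - p ≠ 0 := fun h => by
    rw [h, map_zero] at hone
    exact zero_ne_one hone
  refine (facialDist_le_norm_div b hu).trans ?_
  rw [EReal.coe_le_coe_iff, dist_comm, dist_eq_norm]
  refine div_le_self (norm_nonneg _) ?_
  calc (1 : ℝ) ≤ max ((b.coord i).linear (b i - p)) 0 := by rw [hone]; norm_num
    _ ≤ _ := Finset.single_le_sum (f := fun j => max ((b.coord j).linear (b i - p)) 0)
      (fun _ _ => le_max_right _ _) (Finset.mem_univ i)

end Simplex

/-! ### Widths and closest points of opposite faces -/

section Simplex

variable {ι E : Type*} [Fintype ι] [NormedAddCommGroup E] [InnerProductSpace ℝ E]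
  (b : AffineBasis ι ℝ E)

/-- Let `φ` fix the vertices in `B` and send all others to one point of `B`. The vector `r'` giving
each vertex the `r`-value of its image takes no new values on the vertices, while `r` is its
orthogonal projection to the direction of `B`; thus `‖r‖ ≤ ‖r'‖` and normalizing only helps. -/
theorem width_le_width_of_subset_range [FiniteDimensional ℝ E] {B : Set E} (hB : B ⊆ Set.range b) :
    width (Set.range b) ≤ width B := by
  classical
  refine le_iInf₂ fun r hr => ?_
  obtain ⟨hrB, hr0⟩ := hr
  have hBne : B.Nonempty := by
    by_contra h
    rw [Set.not_nonempty_iff_eq_empty.1 h] at hrB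
    simp at hrB
    exact hr0 hrB
  obtain ⟨v₀, hv₀⟩ := hBne
  set φ : ι → E := fun i => if b i ∈ B then b i else v₀ with hφ
  have hφB : ∀ i, φ i ∈ B := fun i => by simp only [hφ]; split_ifs <;> assumption
  obtain ⟨r', hr'⟩ := exists_inner_eq b fun i => inner ℝ r (φ i)
  have hagree : ∀ u ∈ (affineSpan ℝ B).direction, inner ℝ r' u = inner ℝ r u := by
    intro u hu
    rw [direction_affineSpan] at hu
    refine Submodule.span_induction (p := fun u _ => inner ℝ r' u = inner ℝ r u) ?_ (by simp)
      ?_ ?_ hu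
    · rintro _ ⟨x, hx, y, hy, rfl⟩
      obtain ⟨i, rfl⟩ := hB hx
      obtain ⟨j, rfl⟩ := hB hy
      simp only [vsub_eq_sub, hr', inner_sub_right, hφ, if_pos hx, if_pos hy]
    · intro u v _ _ hu hv
      rw [inner_add_right, inner_add_right, hu, hv]
    · intro a u _ hu
      rw [real_inner_smul_right, real_inner_smul_right, hu]
  have hrpos : 0 < ‖r‖ := norm_pos_iff.2 hr0
  have hle : ‖r‖ ≤ ‖r'‖ := by
    have h1 := hagree r hrB
    have h2 := real_inner_le_norm r' r
    rw [h1, real_inner_self_eq_norm_sq, sq] at h2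
    exact le_of_mul_le_mul_right h2 hrpos
  have hr'0 : r' ≠ 0 := norm_pos_iff.1 (hrpos.trans_le hle)
  have hmem : r' ∈ {r : E | r ∈ (affineSpan ℝ (Set.range b)).direction ∧ r ≠ 0} :=
    ⟨by rw [b.tot, AffineSubspace.direction_top]; exact Submodule.mem_top, hr'0⟩
  refine (iInf₂_le r' hmem).trans (iSup₂_le fun s hs => iSup₂_le fun v hv => ?_)
  obtain ⟨i, rfl⟩ := hs
  obtain ⟨j, rfl⟩ := hv
  rw [real_inner_smul_left, hr', ← inner_sub_right]
  -- Dividing by the larger norm decreases only nonnegative values; a nonpositive one is compared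
  -- with the pair `v₀, v₀`.
  rcases le_total (inner ℝ r (φ i - φ j)) 0 with h | h
  · refine le_trans ?_ (le_iSup₂_of_le v₀ hv₀ (le_iSup₂_of_le v₀ hv₀ le_rfl))
    rw [EReal.coe_le_coe_iff, sub_self, inner_zero_right]
    exact mul_nonpos_of_nonneg_of_nonpos (inv_nonneg.2 (norm_nonneg _)) h
  · refine le_trans ?_ (le_iSup₂_of_le (φ i) (hφB i) (le_iSup₂_of_le (φ j) (hφB j) le_rfl))
    rw [EReal.coe_le_coe_iff, real_inner_smul_left]
    gcongr

theorem width_eq_minWidth [FiniteDimensional ℝ E] : width (Set.range b) = minWidth (Set.range b) :=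
  le_antisymm (le_iInf₂ fun _ hB => width_le_width_of_subset_range b hB)
    (iInf₂_le (f := fun (B : Set E) (_ : B ∈ {B : Set E | B ⊆ Set.range b}) => width B)
      (Set.range b) (Set.Subset.refl _))

theorem inner_eq_of_isMinOn {r x : E} (hx : ∀ i, 0 ≤ b.coord i x)
    (h : ∀ i, 0 < b.coord i x → inner ℝ r x ≤ inner ℝ r (b i)) {i : ι} (hi : 0 < b.coord i x) :
    inner ℝ r (b i) = inner ℝ r x := by
  have h1 : ∑ j, b.coord j x * (inner ℝ r (b j) - inner ℝ r x) = 0 := by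
    simp only [mul_sub, Finset.sum_sub_distrib, ← Finset.sum_mul, b.sum_coord_apply_eq_one, one_mul]
    rw [sub_eq_zero]
    conv_rhs => rw [← b.linear_combination_coord_eq_self x]
    rw [inner_sum]
    simp only [real_inner_smul_right]
  have h2 := (Finset.sum_eq_zero_iff_of_nonneg fun j _ => by
    rcases (hx j).eq_or_lt with h0 | h0
    · simp [← h0]
    · exact mul_nonneg h0.le (sub_nonneg.2 (h j h0))).1 h1 i (Finset.mem_univ i)
  rcases mul_eq_zero.1 h2 with h | h
  · exact absurd h hi.ne'
  · linarith

/-- Closest points of opposite faces of a simplex: the difference is constant on the vertices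
of the carriers of both points. -/
theorem exists_closest_points {I : Set ι} (hI : I.Nonempty) (hI' : Iᶜ.Nonempty) :
    ∃ x ∈ convexHull ℝ (b '' I), ∃ y ∈ convexHull ℝ (b '' Iᶜ), x ≠ y ∧
      (∀ z ∈ convexHull ℝ (b '' I), ∀ w ∈ convexHull ℝ (b '' Iᶜ), dist x y ≤ dist z w) ∧
      (∀ i, 0 < b.coord i x → inner ℝ (x - y) (b i) = inner ℝ (x - y) x) ∧
      (∀ i, 0 < b.coord i y → inner ℝ (x - y) (b i) = inner ℝ (x - y) y) := by
  have hcomp : ∀ J : Set ι, IsCompact (convexHull ℝ (b '' J)) := fun J =>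
    ((Set.toFinite J).image b).isCompact_convexHull ℝ
  have hne : (convexHull ℝ (b '' I) ×ˢ convexHull ℝ (b '' Iᶜ)).Nonempty :=
    ((hI.image b).convexHull).prod ((hI'.image b).convexHull)
  obtain ⟨⟨x, y⟩, ⟨hx, hy⟩, hmin⟩ := ((hcomp I).prod (hcomp Iᶜ)).exists_isMinOn hne
    (continuous_dist.continuousOn)
  have hmin' : ∀ z ∈ convexHull ℝ (b '' I), ∀ w ∈ convexHull ℝ (b '' Iᶜ), dist x y ≤ dist z w :=
    fun z hz w hw => hmin (Set.mk_mem_prod hz hw)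
  have hx' := (mem_convexHull_image_iff b I x).1 hx
  have hy' := (mem_convexHull_image_iff b Iᶜ y).1 hy
  -- The obtuse-angle criterion for a nearest point `v` of `C` to `u`. With it, `⟨x - y, ·⟩` is
  -- minimal at `x` on its face, hence constant on the vertices carrying `x`; symmetrically for `y`.
  have hvar : ∀ {C : Set E} {u v : E}, Convex ℝ C → v ∈ C → (∀ w ∈ C, ‖u - v‖ ≤ ‖u - w‖) →
      ∀ w ∈ C, inner ℝ (u - v) (w - v) ≤ 0 := by
    intro C u v hC hv hle
    have : Nonempty C := ⟨⟨v, hv⟩⟩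
    refine (norm_eq_iInf_iff_real_inner_le_zero hC hv).1 (le_antisymm ?_ ?_)
    · exact le_ciInf fun w => hle w w.2
    · exact ciInf_le ⟨0, by rintro _ ⟨w, rfl⟩; exact norm_nonneg _⟩ (⟨v, hv⟩ : C)
  refine ⟨x, hx, y, hy, ?_, hmin', ?_, ?_⟩
  · rintro rfl
    have h1 := b.sum_coord_apply_eq_one x
    rw [Finset.sum_eq_zero] at h1
    · exact zero_ne_one h1
    · intro i _
      by_cases hi : i ∈ I
      · exact hy'.2 i (fun h => h hi)
      · exact hx'.2 i hi
  · intro i hi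
    refine inner_eq_of_isMinOn b hx'.1 (fun j hj => ?_) hi
    have hjI : j ∈ I := by
      by_contra h
      exact hj.ne' (hx'.2 j h)
    have := hvar (convex_convexHull ℝ _) hx (fun w hw => by
      simpa only [dist_eq_norm, norm_sub_rev] using hmin' w hw y hy : ∀ w ∈ _, ‖y - x‖ ≤ ‖y - w‖)
      (b j) (subset_convexHull ℝ _ ⟨j, hjI, rfl⟩)
    rw [← neg_sub x y, inner_neg_left, inner_sub_right] at this
    linarith
  · intro i hi
    have key : inner ℝ (y - x) (b i) = inner ℝ (y - x) y := by
      refine inner_eq_of_isMinOn b hy'.1 (fun j hj => ?_) hi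
      have hjI : j ∈ Iᶜ := by
        by_contra h
        exact hj.ne' (hy'.2 j h)
      have := hvar (convex_convexHull ℝ _) hy (fun w hw => by
        simpa only [dist_eq_norm] using hmin' x hx w hw : ∀ w ∈ _, ‖x - y‖ ≤ ‖x - w‖)
        (b j) (subset_convexHull ℝ _ ⟨j, hjI, rfl⟩)
      rw [← neg_sub y x, inner_neg_left, inner_sub_right] at this
      linarith
    rw [← neg_sub y x, inner_neg_left, inner_neg_left, key]

theorem mem_convexHull_support {x : E} {J : Set ι} (hx : ∀ i, 0 ≤ b.coord i x)
    (hJ : ∀ i, 0 < b.coord i x → i ∈ J) : x ∈ convexHull ℝ (b '' J) :=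
  (mem_convexHull_image_iff b J x).2 ⟨hx, fun i hi =>
    le_antisymm (not_lt.1 fun h => hi (hJ i h)) (hx i)⟩

/-- A face and the hull of the remaining vertices are spanned by complementary index sets, so only
closest pairs of such hulls need be tested. -/
theorem le_facialDist {a : EReal}
    (h : ∀ x y : E, x ≠ y → (∀ i, 0 ≤ b.coord i x) → (∀ i, 0 ≤ b.coord i y) →
      (∀ i, 0 < b.coord i x → inner ℝ (x - y) (b i) = inner ℝ (x - y) x) →
      (∀ i, 0 < b.coord i y → inner ℝ (x - y) (b i) = inner ℝ (x - y) y) →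
      a ≤ ((dist x y : ℝ) : EReal)) :
    a ≤ facialDist (convexHull ℝ (Set.range b)) := by
  refine le_iInf₂ fun F hF => le_iInf₂ fun z hz => le_iInf₂ fun w hw => ?_
  obtain ⟨hF, -, -⟩ := hF
  rw [vertices_sdiff] at hw
  set I : Set ι := {i | b i ∈ F} with hI
  have hw' : w ∈ convexHull ℝ (b '' Iᶜ) := hw
  have hz' : z ∈ convexHull ℝ (b '' I) :=
    mem_convexHull_support b ((mem_convexHull_range_iff b z).1 (IsExposed.subset hF hz))
      fun i hi => apply_mem_of_mem_faces b hF hz hi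
  have hIne : I.Nonempty := Set.image_nonempty.1 (convexHull_nonempty_iff.1 ⟨z, hz'⟩)
  have hIne' : Iᶜ.Nonempty := Set.image_nonempty.1 (convexHull_nonempty_iff.1 ⟨w, hw'⟩)
  obtain ⟨x, hx, y, hy, hxy, hmin, hxi, hyi⟩ := exists_closest_points b hIne hIne'
  refine (h x y hxy ((mem_convexHull_image_iff b _ x).1 hx).1
    ((mem_convexHull_image_iff b _ y).1 hy).1 hxi hyi).trans ?_
  exact EReal.coe_le_coe_iff.2 (hmin z hz' w hw')

theorem inner_normalized_le_dist {x y s v : E}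
    (hs : inner ℝ (x - y) s = inner ℝ (x - y) x ∨ inner ℝ (x - y) s = inner ℝ (x - y) y)
    (hv : inner ℝ (x - y) v = inner ℝ (x - y) x ∨ inner ℝ (x - y) v = inner ℝ (x - y) y) :
    inner ℝ (‖x - y‖⁻¹ • (x - y)) (s - v) ≤ dist x y := by
  have h1 : inner ℝ (x - y) x - inner ℝ (x - y) y = ‖x - y‖ ^ 2 := by
    rw [← inner_sub_right, real_inner_self_eq_norm_sq]
  have h2 : inner ℝ (x - y) (s - v) ≤ ‖x - y‖ ^ 2 := by
    have := sq_nonneg ‖x - y‖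
    rw [inner_sub_right]
    rcases hs with hs | hs <;> rcases hv with hv | hv <;> rw [hs, hv] <;> linarith
  rw [real_inner_smul_left, dist_eq_norm]
  rcases (norm_nonneg (x - y)).eq_or_lt with h | h
  · simp [← h]
  · rw [inv_mul_le_iff₀ h, ← sq]
    exact h2

/-- The subset to use consists of the vertices carrying `x` or `y`: there `⟨x - y, ·⟩` takes only
the two values at `x` and `y`, which differ by `‖x - y‖ ^ 2`. -/
theorem minWidth_le_facialDist :
    minWidth (Set.range b) ≤ facialDist (convexHull ℝ (Set.range b)) := by
  refine le_facialDist b fun x y hxy hx hy hxi hyi => ?_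
  set J : Set ι := {i | 0 < b.coord i x ∨ 0 < b.coord i y} with hJ
  have hxJ := convexHull_subset_affineSpan (b '' J)
    (mem_convexHull_support b hx fun i hi => Or.inl hi : x ∈ convexHull ℝ (b '' J))
  have hyJ := convexHull_subset_affineSpan (b '' J)
    (mem_convexHull_support b hy fun i hi => Or.inr hi : y ∈ convexHull ℝ (b '' J))
  have hmem : x - y ∈ {r : E | r ∈ (affineSpan ℝ (b '' J)).direction ∧ r ≠ 0} :=
    ⟨AffineSubspace.vsub_mem_direction hxJ hyJ, sub_ne_zero.2 hxy⟩
  refine (iInf₂_le (b '' J) (Set.image_subset_range b J)).trans ((iInf₂_le (x - y) hmem).trans ?_)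
  have hor : ∀ i ∈ J, inner ℝ (x - y) (b i) = inner ℝ (x - y) x ∨
      inner ℝ (x - y) (b i) = inner ℝ (x - y) y := fun i hi => hi.imp (hxi i) (hyi i)
  refine iSup₂_le fun s hs => iSup₂_le fun v hv => ?_
  obtain ⟨i, hi, rfl⟩ := hs
  obtain ⟨j, hj, rfl⟩ := hv
  exact EReal.coe_le_coe_iff.2 (inner_normalized_le_dist (hor i hi) (hor j hj))

/-- The competitor is the face spanned by the vertices carrying `x` or `y`, with base point `y`,
direction `x - y`, and `T` the vertices carrying `y`. -/
theorem pyramidalWidth_le_facialDist [FiniteDimensional ℝ E] :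
    pyramidalWidth (Set.range b) ≤ facialDist (convexHull ℝ (Set.range b)) := by
  classical
  refine le_facialDist b fun x y hxy hx hy hxi hyi => ?_
  set J : Set ι := {i | 0 < b.coord i x ∨ 0 < b.coord i y} with hJ
  have hxJ : x ∈ convexHull ℝ (b '' J) := mem_convexHull_support b hx fun i hi => Or.inl hi
  have hyJ : y ∈ convexHull ℝ (b '' J) := mem_convexHull_support b hy fun i hi => Or.inr hi
  have hmem : x - y ∈ {r : E | r ∈ PointedCone.hull ℝ ((fun z => z - y) '' convexHull ℝ (b '' J)) ∧
      r ≠ 0} := ⟨Submodule.subset_span ⟨x, hxJ, rfl⟩, sub_ne_zero.2 hxy⟩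
  refine (iInf₂_le _ (convexHull_image_mem_faces b J)).trans ((iInf₂_le y hyJ).trans
    ((iInf₂_le (x - y) hmem).trans ?_))
  have hor : ∀ i ∈ J, inner ℝ (x - y) (b i) = inner ℝ (x - y) x ∨
      inner ℝ (x - y) (b i) = inner ℝ (x - y) y := fun i hi => hi.imp (hxi i) (hyi i)
  set P := Finset.univ.filter fun i => 0 < b.coord i y with hP
  have hinj : ∀ i ∈ P, ∀ j ∈ P, b i = b j → i = j := fun _ _ _ _ h => b.ind.injective h
  have hcoord : ∀ i, ∑ j, b.coord j (b i) * b.coord j y = b.coord i y := fun i => by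
    simp [b.coord_apply]
  have hT : P.image b ∈ {T : Finset E | (T : Set E) ⊆ convexHull ℝ (b '' J) ∩ Set.range b ∧
      IsProperConvexCombination y T} := by
    refine ⟨?_, fun v => ∑ j, b.coord j v * b.coord j y, ?_, ?_, ?_⟩
    · intro v hv
      obtain ⟨i, hi, rfl⟩ := Finset.mem_image.1 hv
      exact ⟨subset_convexHull ℝ _ ⟨i, Or.inr (Finset.mem_filter.1 hi).2, rfl⟩, i, rfl⟩
    · intro v hv
      obtain ⟨i, hi, rfl⟩ := Finset.mem_image.1 hv
      change 0 < ∑ j, b.coord j (b i) * b.coord j y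
      rw [hcoord]
      exact (Finset.mem_filter.1 hi).2
    · rw [Finset.sum_image hinj]
      simp only [hcoord]
      rw [Finset.sum_filter_of_ne, b.sum_coord_apply_eq_one]
      exact fun i _ hi => lt_of_le_of_ne (hy i) hi.symm
    · rw [Finset.sum_image hinj]
      simp only [hcoord]
      rw [Finset.sum_filter_of_ne, b.linear_combination_coord_eq_self]
      exact fun i _ hi => lt_of_le_of_ne (hy i) fun h => hi (by rw [← h, zero_smul])
  refine (iInf₂_le _ hT).trans (iSup₂_le fun s hs => iSup₂_le fun v hv => ?_)
  obtain ⟨hs, i, rfl⟩ := hs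
  obtain ⟨j, hj, rfl⟩ := Finset.mem_image.1 hv
  exact EReal.coe_le_coe_iff.2 (inner_normalized_le_dist
    (hor i ((apply_mem_convexHull_image_iff b J i).1 hs))
    (hor j (Or.inr (Finset.mem_filter.1 hj).2)))

theorem vertexFacetDist_le_dist [FiniteDimensional ℝ E] (i : ι) (hι : 1 < Fintype.card ι) {p : E}
    (hp : b.coord i p = 0) :
    vertexFacetDist (convexHull ℝ (Set.range b)) ≤ ((dist p (b i) : ℝ) : EReal) := by
  classical
  set J : Set ι := {i}ᶜ with hJ
  have hcard : Fintype.card J + 1 = Fintype.card ι := by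
    have h := Set.ncard_add_ncard_compl ({i} : Set ι)
    rw [Set.ncard_singleton, ← Nat.card_coe_set_eq, Nat.card_eq_fintype_card,
      Nat.card_eq_fintype_card] at h
    rw [← h, add_comm]
  have hJne : J.Nonempty := by
    rw [← Set.nonempty_coe_sort, ← Fintype.card_pos_iff]
    omega
  have hfacet : convexHull ℝ (b '' J) ∈ facets (convexHull ℝ (Set.range b)) := by
    refine ⟨convexHull_image_mem_faces b J, (hJne.image b).convexHull, ?_⟩
    rw [affineSpan_convexHull, affineSpan_convexHull, direction_affineSpan, direction_affineSpan,
      Set.image_eq_range]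
    have hpos : 0 < Fintype.card J := Fintype.card_pos_iff.2 hJne.to_subtype
    have h1 := (b.ind.comp_embedding (Function.Embedding.subtype (· ∈ J))).finrank_vectorSpan
      (n := Fintype.card J - 1) (Nat.sub_add_cancel hpos).symm
    have h2 := b.ind.finrank_vectorSpan (n := Fintype.card J) hcard.symm
    rw [h2]
    have h3 : Set.range (fun x : J => b x) =
      Set.range (⇑b ∘ (Function.Embedding.subtype (· ∈ J))) := rfl
    rw [h3, h1, Nat.sub_add_cancel hpos]
  have hpaff : p ∈ (affineSpan ℝ (convexHull ℝ (b '' J)) : Set E) := by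
    rw [affineSpan_convexHull]
    have h1 : ∑ j ∈ Finset.univ.erase i, b.coord j p = 1 := by
      rw [Finset.sum_erase (f := fun j => b.coord j p) _ hp, b.sum_coord_apply_eq_one]
    have h2 : (Finset.univ.erase i).affineCombination ℝ b (fun j => b.coord j p) = p := by
      rw [Finset.affineCombination_eq_linear_combination _ _ _ h1,
        Finset.sum_erase _ (by rw [hp, zero_smul]), b.linear_combination_coord_eq_self]
    rw [← h2]
    have h3 := affineCombination_mem_affineSpan_image (k := ℝ) h1
      (s' := J) (fun j _ hj' => ?_) b
    · exact h3
    · simp only [hJ, Set.mem_compl_iff, Set.mem_singleton_iff, not_not] at hj'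
      rw [hj', hp]
  have hv : b i ∈ vertices (convexHull ℝ (Set.range b)) \ convexHull ℝ (b '' J) := by
    rw [vertices_convexHull_range]
    exact ⟨⟨i, rfl⟩, fun h => (apply_mem_convexHull_image_iff b J i).1 h rfl⟩
  exact (iInf₂_le _ hfacet).trans ((iInf₂_le p hpaff).trans (iInf₂_le (b i) hv))

end Simplex

/-! ### Walsh characters and the chain of index sets -/

section Walsh

/-- The Walsh function of a finite set of coordinates. -/
def walsh (a x : Finset ℕ) : ℝ := ∏ i ∈ a, if i ∈ x then -1 else 1

/-- Finite sets of naturals, ordered by their binary value. -/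
def binaryRank (a : Finset ℕ) : ℕ := ∑ i ∈ a, 2 ^ i

theorem walsh_mul_self (a x : Finset ℕ) : walsh a x * walsh a x = 1 := by
  rw [walsh, ← Finset.prod_mul_distrib]
  exact Finset.prod_eq_one fun i _ => by split_ifs <;> norm_num

theorem walsh_eq_or (a x : Finset ℕ) : walsh a x = 1 ∨ walsh a x = -1 :=
  mul_self_eq_one_iff.1 (walsh_mul_self a x)

theorem walsh_empty_left (x : Finset ℕ) : walsh ∅ x = 1 := rfl

theorem walsh_empty_right (a : Finset ℕ) : walsh a ∅ = 1 := by simp [walsh]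

theorem walsh_insert {m : ℕ} {a : Finset ℕ} (h : m ∉ a) (x : Finset ℕ) :
    walsh (insert m a) x = (if m ∈ x then -1 else 1) * walsh a x := Finset.prod_insert h

theorem walsh_union {a a' : Finset ℕ} (h : Disjoint a a') (x : Finset ℕ) :
    walsh (a ∪ a') x = walsh a x * walsh a' x := Finset.prod_union h

theorem walsh_eq_one_of_disjoint {a x : Finset ℕ} (h : Disjoint a x) : walsh a x = 1 :=
  Finset.prod_eq_one fun _ hi => if_neg (Finset.disjoint_left.1 h hi)

theorem sum_powerset_walsh (v x : Finset ℕ) :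
    ∑ s ∈ v.powerset, walsh s x = if Disjoint v x then 2 ^ v.card else 0 := by
  simp only [walsh, ← Finset.prod_one_add]
  split_ifs with h
  · rw [Finset.prod_congr rfl fun i hi => by rw [if_neg (Finset.disjoint_left.1 h hi)],
      Finset.prod_const]
    norm_num
  · obtain ⟨i, hi, hx⟩ := Finset.not_disjoint_iff.1 h
    exact Finset.prod_eq_zero hi (by simp [hx])

theorem sum_powerset_walsh_mul_walsh {v x y : Finset ℕ} (hx : x ⊆ v) (hy : y ⊆ v) :
    ∑ s ∈ v.powerset, walsh s x * walsh s y = if x = y then 2 ^ v.card else 0 := by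
  simp only [walsh, ← Finset.prod_mul_distrib, ← Finset.prod_one_add]
  split_ifs with h
  · subst h
    rw [Finset.prod_congr rfl fun i _ => show _ = (2 : ℝ) by split_ifs <;> norm_num,
      Finset.prod_const]
  · have : ∃ i ∈ v, ¬(i ∈ x ↔ i ∈ y) := by
      by_contra! hall
      refine h (Finset.ext fun i => ⟨fun hi => (hall i (hx hi)).1 hi, fun hi => ?_⟩)
      exact (hall i (hy hi)).2 hi
    obtain ⟨i, hi, hne⟩ := this
    refine Finset.prod_eq_zero hi ?_
    by_cases h1 : i ∈ x <;> by_cases h2 : i ∈ y <;> simp_all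

theorem binaryRank_injective : Function.Injective binaryRank := Finset.geomSum_injective le_rfl

theorem binaryRank_insert {m : ℕ} {a : Finset ℕ} (h : m ∉ a) :
    binaryRank (insert m a) = 2 ^ m + binaryRank a := Finset.sum_insert h

theorem binaryRank_mono {a a' : Finset ℕ} (h : a ⊆ a') : binaryRank a ≤ binaryRank a' :=
  Finset.sum_le_sum_of_subset h

theorem binaryRank_lt_two_pow {m : ℕ} {a : Finset ℕ} (h : a ⊆ Finset.range m) :
    binaryRank a < 2 ^ m := by
  refine (binaryRank_mono h).trans_lt ?_
  have := Nat.geomSum_eq (le_refl 2) m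
  rw [binaryRank, this]
  have := Nat.one_le_two_pow (n := m)
  simp

/-- The set of sets used along the growing chain: at least `3 - j` elements, in `range m`. -/
def chainSets (m j : ℕ) : Finset (Finset ℕ) :=
  (Finset.range m).powerset.filter fun a => 3 ≤ a.card + j

theorem mem_chainSets {m j : ℕ} {a : Finset ℕ} :
    a ∈ chainSets m j ↔ a ⊆ Finset.range m ∧ 3 ≤ a.card + j := by
  simp [chainSets]

/-- `p` is the predecessor of `a` in the chain, and `F` is an affine family of sets through
`p` and `a` all of whose members come before `a` or are off the chain. -/
structure IsStep (m j : ℕ) (a p : Finset ℕ) (F : Finset (Finset ℕ)) : Prop where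
  pred_mem : p ∈ chainSets m j
  pred_lt : binaryRank p < binaryRank a
  le_pred : ∀ s ∈ chainSets m j, binaryRank s < binaryRank a → binaryRank s ≤ binaryRank p
  pred_mem_family : p ∈ F
  self_mem_family : a ∈ F
  card_family : F.card = 2 ^ a.card
  family_subset : ∀ s ∈ F, s ⊆ Finset.range m
  family_le : ∀ s ∈ F, s ∈ chainSets m j → binaryRank s ≤ binaryRank a
  sum_walsh : ∀ x, ∑ s ∈ F, walsh s x = 0 ∨ ∑ s ∈ F, walsh s x = F.card * walsh p x

theorem chainSets_succ_cases {m j : ℕ} {a : Finset ℕ} (ha : a ∈ chainSets (m + 1) j) :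
    a ∈ chainSets m j ∨ ∃ v ∈ chainSets m (j + 1), a = insert m v := by
  rw [mem_chainSets] at ha
  by_cases hm : m ∈ a
  · have hc := Finset.card_erase_add_one hm
    refine Or.inr ⟨a.erase m, mem_chainSets.2 ⟨fun i hi => ?_, by omega⟩,
      (Finset.insert_erase hm).symm⟩
    have h1 := Finset.mem_range.1 (ha.1 (Finset.mem_of_mem_erase hi))
    have h2 := Finset.ne_of_mem_erase hi
    exact Finset.mem_range.2 (by omega)
  · refine Or.inl (mem_chainSets.2 ⟨fun i hi => ?_, ha.2⟩)
    have h1 := Finset.mem_range.1 (ha.1 hi)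
    have h2 : i ≠ m := fun h => hm (h ▸ hi)
    exact Finset.mem_range.2 (by omega)

theorem notMem_of_subset_range {m : ℕ} {a : Finset ℕ} (h : a ⊆ Finset.range m) : m ∉ a :=
  fun hm => by simpa using h hm

theorem chainSets_subset_succ {m j : ℕ} {a : Finset ℕ} (ha : a ∈ chainSets m j) :
    a ∈ chainSets (m + 1) j := by
  rw [mem_chainSets] at ha ⊢
  exact ⟨ha.1.trans (Finset.range_mono (Nat.le_succ m)), ha.2⟩

theorem insert_subset_range_succ {m : ℕ} {a : Finset ℕ} (h : a ⊆ Finset.range m) :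
    insert m a ⊆ Finset.range (m + 1) := by
  rw [Finset.range_add_one]
  exact Finset.insert_subset_insert m h

theorem insert_mem_chainSets_iff {m j : ℕ} {a : Finset ℕ} (h : a ⊆ Finset.range m) :
    insert m a ∈ chainSets (m + 1) j ↔ a ∈ chainSets m (j + 1) := by
  rw [mem_chainSets, mem_chainSets, Finset.card_insert_of_notMem (notMem_of_subset_range h)]
  have := insert_subset_range_succ h
  constructor
  · rintro ⟨-, h2⟩; exact ⟨h, by omega⟩
  · rintro ⟨-, h2⟩; exact ⟨this, by omega⟩

theorem binaryRank_lt_insert {m : ℕ} {a v : Finset ℕ} (ha : a ⊆ Finset.range m)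
    (hv : v ⊆ Finset.range m) : binaryRank a < binaryRank (insert m v) := by
  rw [binaryRank_insert (notMem_of_subset_range hv)]
  exact (binaryRank_lt_two_pow ha).trans_le (Nat.le_add_right _ _)

theorem IsStep.succ {m j : ℕ} {a p : Finset ℕ} {F : Finset (Finset ℕ)} (h : IsStep m j a p F)
    (ha : a ⊆ Finset.range m) : IsStep (m + 1) j a p F where
  pred_mem := chainSets_subset_succ h.pred_mem
  pred_lt := h.pred_lt
  le_pred s hs hlt := by
    rcases chainSets_succ_cases hs with hs | ⟨v, hv, rfl⟩
    · exact h.le_pred s hs hlt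
    · exact absurd hlt (binaryRank_lt_insert ha (mem_chainSets.1 hv).1).not_gt
  pred_mem_family := h.pred_mem_family
  self_mem_family := h.self_mem_family
  card_family := h.card_family
  family_subset s hs := (h.family_subset s hs).trans (Finset.range_mono (Nat.le_succ m))
  family_le s hs hsc := by
    rcases chainSets_succ_cases hsc with hsc | ⟨v, hv, rfl⟩
    · exact h.family_le s hs hsc
    · exact absurd (Finset.mem_insert_self m v) (notMem_of_subset_range (h.family_subset _ hs))
  sum_walsh := h.sum_walsh

theorem injOn_insert {m : ℕ} {F : Finset (Finset ℕ)} (hF : ∀ s ∈ F, s ⊆ Finset.range m) :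
    Set.InjOn (insert m) (F : Set (Finset ℕ)) := fun s hs t ht h => by
  rw [← Finset.erase_insert (notMem_of_subset_range (hF s hs)), h,
    Finset.erase_insert (notMem_of_subset_range (hF t ht))]

theorem disjoint_image_insert {m : ℕ} {F G : Finset (Finset ℕ)} (hF : ∀ s ∈ F, s ⊆ Finset.range m) :
    Disjoint F (G.image (insert m)) := by
  rw [Finset.disjoint_left]
  intro s hs hs'
  obtain ⟨t, -, rfl⟩ := Finset.mem_image.1 hs'
  exact notMem_of_subset_range (hF _ hs) (Finset.mem_insert_self m t)

theorem sum_image_insert_walsh {m : ℕ} {F : Finset (Finset ℕ)} (hF : ∀ s ∈ F, s ⊆ Finset.range m)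
    (x : Finset ℕ) : ∑ s ∈ F.image (insert m), walsh s x =
      (if m ∈ x then -1 else 1) * ∑ s ∈ F, walsh s x := by
  rw [Finset.sum_image (injOn_insert hF), Finset.mul_sum]
  exact Finset.sum_congr rfl fun s hs => walsh_insert (notMem_of_subset_range (hF s hs)) x

/-- Adding `m` to every set preserves order. Taking the family together with its translate doubles
it, and the sum of characters is multiplied by `1 ± 1`. -/
theorem IsStep.insert {m j : ℕ} {v p : Finset ℕ} {F : Finset (Finset ℕ)}
    (h : IsStep m (j + 1) v p F) (hv : v ⊆ Finset.range m) :
    IsStep (m + 1) j (insert m v) (insert m p) (F ∪ F.image (insert m)) where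
  pred_mem := (insert_mem_chainSets_iff (mem_chainSets.1 h.pred_mem).1).2 h.pred_mem
  pred_lt := by
    rw [binaryRank_insert (notMem_of_subset_range hv),
      binaryRank_insert (notMem_of_subset_range (mem_chainSets.1 h.pred_mem).1)]
    exact Nat.add_lt_add_left h.pred_lt _
  le_pred s hs hlt := by
    have hp := (mem_chainSets.1 h.pred_mem).1
    rcases chainSets_succ_cases hs with hs | ⟨t, ht, rfl⟩
    · exact (binaryRank_lt_insert (mem_chainSets.1 hs).1 hp).le
    · have htm := notMem_of_subset_range (mem_chainSets.1 ht).1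
      rw [binaryRank_insert htm, binaryRank_insert (notMem_of_subset_range hv)] at hlt
      rw [binaryRank_insert htm, binaryRank_insert (notMem_of_subset_range hp)]
      exact Nat.add_le_add_left (h.le_pred t ht (Nat.lt_of_add_lt_add_left hlt)) _
  pred_mem_family := Finset.mem_union_right _ (Finset.mem_image_of_mem _ h.pred_mem_family)
  self_mem_family := Finset.mem_union_right _ (Finset.mem_image_of_mem _ h.self_mem_family)
  card_family := by
    rw [Finset.card_union_of_disjoint (disjoint_image_insert h.family_subset),
      Finset.card_image_of_injOn (injOn_insert h.family_subset), h.card_family,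
      Finset.card_insert_of_notMem (notMem_of_subset_range hv), pow_succ, mul_two]
  family_subset s hs := by
    rcases Finset.mem_union.1 hs with hs | hs
    · exact (h.family_subset s hs).trans (Finset.range_mono (Nat.le_succ m))
    · obtain ⟨t, ht, rfl⟩ := Finset.mem_image.1 hs
      exact insert_subset_range_succ (h.family_subset t ht)
  family_le s hs hsc := by
    rcases Finset.mem_union.1 hs with hs | hs
    · exact (binaryRank_lt_insert (h.family_subset s hs) hv).le
    · obtain ⟨t, ht, rfl⟩ := Finset.mem_image.1 hs
      have htm := h.family_subset t ht
      rw [binaryRank_insert (notMem_of_subset_range htm),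
        binaryRank_insert (notMem_of_subset_range hv)]
      exact Nat.add_le_add_left (h.family_le t ht ((insert_mem_chainSets_iff htm).1 hsc)) _
  sum_walsh x := by
    rw [Finset.card_union_of_disjoint (disjoint_image_insert h.family_subset),
      Finset.card_image_of_injOn (injOn_insert h.family_subset),
      Finset.sum_union (disjoint_image_insert h.family_subset),
      sum_image_insert_walsh h.family_subset,
      walsh_insert (notMem_of_subset_range (mem_chainSets.1 h.pred_mem).1)]
    split_ifs
    · left; ring
    · rcases h.sum_walsh x with h0 | h0
      · left; rw [h0]; ring
      · right; rw [h0]; push_cast; ring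

/-- The step from the last set without `m`, namely `range m`, to the first one with `m`. The family
consists of two translates of the subsets of `v`, one through each of these two sets. -/
theorem isStep_link {m j : ℕ} {v : Finset ℕ} (hv : v ∈ chainSets m (j + 1))
    (hmin : ∀ s ∈ chainSets m (j + 1), binaryRank v ≤ binaryRank s)
    (hne : Finset.range m ∈ chainSets m j) :
    IsStep (m + 1) j (insert m v) (Finset.range m)
      (v.powerset.image (fun s => (Finset.range m \ v) ∪ s) ∪ v.powerset.image (insert m)) := by
  have hvm := (mem_chainSets.1 hv).1
  have hpow : ∀ s ∈ v.powerset, s ⊆ Finset.range m := fun s hs =>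
    (Finset.mem_powerset.1 hs).trans hvm
  have hdisj : ∀ s ∈ v.powerset, Disjoint (Finset.range m \ v) s := fun s hs =>
    Finset.sdiff_disjoint.mono_right (Finset.mem_powerset.1 hs)
  have hsub : ∀ s ∈ v.powerset.image (fun s => (Finset.range m \ v) ∪ s), s ⊆ Finset.range m := by
    intro s hs
    obtain ⟨t, ht, rfl⟩ := Finset.mem_image.1 hs
    exact Finset.union_subset Finset.sdiff_subset (hpow t ht)
  have hinj : Set.InjOn (fun s => (Finset.range m \ v) ∪ s) (v.powerset : Set (Finset ℕ)) := by
    intro s hs t ht h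
    have h1 := Finset.union_sdiff_cancel_left (hdisj s hs)
    have h2 := Finset.union_sdiff_cancel_left (hdisj t ht)
    rw [← h1, ← h2]
    exact congrArg (· \ (Finset.range m \ v)) h
  have hcard : (v.powerset.image (fun s => (Finset.range m \ v) ∪ s) ∪
      v.powerset.image (Insert.insert m)).card = 2 ^ (v.card + 1) := by
    rw [Finset.card_union_of_disjoint (disjoint_image_insert hsub),
      Finset.card_image_of_injOn (injOn_insert hpow), Finset.card_image_of_injOn hinj,
      Finset.card_powerset, pow_succ, mul_two]
  refine ⟨chainSets_subset_succ hne, binaryRank_lt_insert subset_rfl hvm, ?_, ?_, ?_, ?_, ?_, ?_, ?_⟩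
  · intro s hs hlt
    rcases chainSets_succ_cases hs with hs | ⟨t, ht, rfl⟩
    · exact binaryRank_mono (mem_chainSets.1 hs).1
    · rw [binaryRank_insert (notMem_of_subset_range (mem_chainSets.1 ht).1),
        binaryRank_insert (notMem_of_subset_range hvm)] at hlt
      exact absurd (Nat.lt_of_add_lt_add_left hlt) (hmin t ht).not_gt
  · refine Finset.mem_union_left _ (Finset.mem_image.2 ⟨v, Finset.mem_powerset_self v, ?_⟩)
    exact Finset.sdiff_union_of_subset hvm
  · exact Finset.mem_union_right _ (Finset.mem_image_of_mem _ (Finset.mem_powerset_self v))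
  · rw [hcard, Finset.card_insert_of_notMem (notMem_of_subset_range hvm)]
  · intro s hs
    rcases Finset.mem_union.1 hs with hs | hs
    · exact (hsub s hs).trans (Finset.range_mono (Nat.le_succ m))
    · obtain ⟨t, ht, rfl⟩ := Finset.mem_image.1 hs
      exact insert_subset_range_succ (hpow t ht)
  · intro s hs _
    rcases Finset.mem_union.1 hs with hs | hs
    · exact (binaryRank_lt_insert (hsub s hs) hvm).le
    · obtain ⟨t, ht, rfl⟩ := Finset.mem_image.1 hs
      exact binaryRank_mono (Finset.insert_subset_insert m (Finset.mem_powerset.1 ht))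
  · intro x
    have hsum : ∑ s ∈ v.powerset.image (fun s => (Finset.range m \ v) ∪ s), walsh s x =
        walsh (Finset.range m \ v) x * ∑ s ∈ v.powerset, walsh s x := by
      rw [Finset.sum_image hinj, Finset.mul_sum]
      exact Finset.sum_congr rfl fun s hs => walsh_union (hdisj s hs) x
    rw [hcard, Finset.sum_union (disjoint_image_insert hsub), sum_image_insert_walsh hpow, hsum,
      sum_powerset_walsh]
    -- If `x` meets `v`, both translates sum to zero. Otherwise each contributes `2 ^ |v|` times a
    -- sign, and the signs either cancel or agree with `walsh (range m) x`.
    by_cases h1 : Disjoint v x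
    · have hp : walsh (Finset.range m) x = walsh (Finset.range m \ v) x := by
        conv_lhs => rw [← Finset.sdiff_union_of_subset hvm]
        rw [walsh_union Finset.sdiff_disjoint, walsh_eq_one_of_disjoint h1, mul_one]
      rw [if_pos h1, hp]
      push_cast
      rcases walsh_eq_or (Finset.range m \ v) x with h | h <;> rw [h] <;> split_ifs <;>
        first | (left; ring1) | (right; ring1)
    · rw [if_neg h1]
      left; ring

/-- In binary order the chain at `m + 1` is the chain at `m` followed by the chain of index `j + 1`
with `m` inserted. A step lies inside one of the halves or is the link between them. -/
theorem exists_isStep (m : ℕ) : ∀ (j : ℕ), ∀ a ∈ chainSets m j,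
    (∀ s ∈ chainSets m j, binaryRank a ≤ binaryRank s) ∨ ∃ p F, IsStep m j a p F := by
  induction m with
  | zero =>
    intro j a ha
    left
    intro s _
    have : a = ∅ := by simpa using (mem_chainSets.1 ha).1
    rw [this]
    exact binaryRank_mono (Finset.empty_subset s)
  | succ m ih =>
    intro j a ha
    rcases chainSets_succ_cases ha with ha | ⟨v, hv, rfl⟩
    · have ham := (mem_chainSets.1 ha).1
      rcases ih j a ha with hmin | ⟨p, F, h⟩
      · left
        intro s hs
        rcases chainSets_succ_cases hs with hs | ⟨t, ht, rfl⟩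
        · exact hmin s hs
        · exact (binaryRank_lt_insert ham (mem_chainSets.1 ht).1).le
      · exact Or.inr ⟨p, F, h.succ ham⟩
    · have hvm := (mem_chainSets.1 hv).1
      rcases ih (j + 1) v hv with hmin | ⟨p, F, h⟩
      · by_cases hne : Finset.range m ∈ chainSets m j
        · exact Or.inr ⟨_, _, isStep_link hv hmin hne⟩
        · left
          intro s hs
          rcases chainSets_succ_cases hs with hs | ⟨t, ht, rfl⟩
          · refine absurd (mem_chainSets.2 ⟨subset_rfl, ?_⟩) hne
            rw [mem_chainSets] at hs
            have := Finset.card_le_card hs.1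
            omega
          · rw [binaryRank_insert (notMem_of_subset_range hvm),
              binaryRank_insert (notMem_of_subset_range (mem_chainSets.1 ht).1)]
            exact Nat.add_le_add_left (hmin t ht) _
      · exact Or.inr ⟨_, _, h.insert hvm⟩

end Walsh

/-! ### Gluing 0/1 matrices with large inverse entries -/

section LargeInverse

/-- There is an invertible 0/1 matrix indexed by `ι` whose inverse has an entry of absolute value
at least `c`. -/
def HasLargeInverseEntry (ι : Type) [Fintype ι] (c : ℝ) : Prop :=
  ∃ (M : ι → ι → ℝ) (y : ι → ℝ) (t s : ι), (∀ i j, M i j = 0 ∨ M i j = 1) ∧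
    (∀ z : ι → ℝ, (∀ i, ∑ j, M i j * z j = 0) → z = 0) ∧
    (∀ i, i ≠ t → ∑ j, M i j * y j = 0) ∧ ∑ j, M t j * y j = 1 ∧ c ≤ |y s|

theorem HasLargeInverseEntry.congr {ι κ : Type} [Fintype ι] [Fintype κ] (e : ι ≃ κ) {c : ℝ}
    (h : HasLargeInverseEntry ι c) : HasLargeInverseEntry κ c := by
  obtain ⟨M, y, t, s, h01, hker, h0, h1, hc⟩ := h
  have hsum : ∀ (i : κ) (z : κ → ℝ), ∑ j, M (e.symm i) (e.symm j) * z j =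
      ∑ j, M (e.symm i) j * z (e j) := fun i z =>
    Fintype.sum_equiv e.symm _ _ fun j => by rw [e.apply_symm_apply]
  refine ⟨fun i j => M (e.symm i) (e.symm j), fun j => y (e.symm j), e t, e s,
    fun i j => h01 _ _, fun z hz => ?_, fun i hi => ?_, ?_, ?_⟩
  · have := hker (fun j => z (e j)) fun i => by
      have := hz (e i)
      rwa [hsum, e.symm_apply_apply] at this
    funext j
    have := congrFun this (e.symm j)
    simpa using this
  · rw [hsum]
    simpa using h0 (e.symm i) fun h => hi (by rw [← h, e.apply_symm_apply])
  · rw [hsum]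
    simpa using h1
  · simpa using hc

theorem HasLargeInverseEntry.mono {ι : Type} [Fintype ι] {c c' : ℝ} (hc : c' ≤ c)
    (h : HasLargeInverseEntry ι c) : HasLargeInverseEntry ι c' := by
  obtain ⟨M, y, t, s, h01, hker, h0, h1, hs⟩ := h
  exact ⟨M, y, t, s, h01, hker, h0, h1, hc.trans hs⟩

/-- Use a block triangular matrix with diagonal blocks `M`, `M'` and a single `1` in row `t'`,
column `s`. That entry feeds `y s` into the second system, whose solution becomes `-y s * y'`. -/
theorem HasLargeInverseEntry.sum {ι κ : Type} [Fintype ι] [Fintype κ] {c c' : ℝ} (hc : 0 ≤ c')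
    (h : HasLargeInverseEntry ι c) (h' : HasLargeInverseEntry κ c') :
    HasLargeInverseEntry (ι ⊕ κ) (c * c') := by
  classical
  obtain ⟨M, y, t, s, h01, hker, h0, h1, hs⟩ := h
  obtain ⟨M', y', t', s', h01', hker', h0', h1', hs'⟩ := h'
  let N : ι ⊕ κ → ι ⊕ κ → ℝ := Sum.elim (fun i => Sum.elim (M i) fun _ => 0)
    fun i => Sum.elim (fun j => if i = t' ∧ j = s then 1 else 0) (M' i)
  have hl : ∀ (i : ι) (z : ι ⊕ κ → ℝ), ∑ j, N (Sum.inl i) j * z j = ∑ j, M i j * z (Sum.inl j) :=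
    fun i z => by simp [N, Fintype.sum_sum_type]
  have hr : ∀ (i : κ) (z : ι ⊕ κ → ℝ), ∑ j, N (Sum.inr i) j * z j =
      (if i = t' then z (Sum.inl s) else 0) + ∑ j, M' i j * z (Sum.inr j) := fun i z => by
    by_cases hi : i = t' <;> simp [N, Fintype.sum_sum_type, hi]
  have hmul : ∀ i, ∑ j, M' i j * (-y s * y' j) = -y s * ∑ j, M' i j * y' j := fun i => by
    rw [Finset.mul_sum]
    exact Finset.sum_congr rfl fun j _ => by ring
  refine ⟨N, Sum.elim y fun j => -y s * y' j, Sum.inl t, Sum.inr s', ?_, ?_, ?_, ?_, ?_⟩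
  · rintro (i | i) (j | j)
    · exact h01 i j
    · exact Or.inl rfl
    · simp only [N, Sum.elim_inr, Sum.elim_inl]
      split_ifs <;> simp
    · exact h01' i j
  · intro z hz
    have hz1 := hker (fun j => z (Sum.inl j)) fun i => by rw [← hl]; exact hz _
    have hz2 := hker' (fun j => z (Sum.inr j)) fun i => by
      have := hz (Sum.inr i)
      rw [hr, congrFun hz1 s] at this
      simpa using this
    funext j
    rcases j with j | j
    · exact congrFun hz1 j
    · exact congrFun hz2 j
  · rintro (i | i) hi
    · rw [hl]
      exact h0 i fun h => hi (h ▸ rfl)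
    · rw [hr]
      simp only [Sum.elim_inl, Sum.elim_inr, hmul]
      by_cases h : i = t'
      · rw [if_pos h, h, h1']; ring
      · rw [if_neg h, h0' i h]; ring
  · rw [hl]
    exact h1
  · simp only [Sum.elim_inr, abs_mul, abs_neg]
    exact mul_le_mul hs hs' hc (abs_nonneg _)

theorem hasLargeInverseEntry_one (ι : Type) [Fintype ι] [Nonempty ι] :
    HasLargeInverseEntry ι 1 := by
  classical
  obtain ⟨t⟩ := ‹Nonempty ι›
  refine ⟨fun i j => if i = j then 1 else 0, fun j => if j = t then 1 else 0, t, t, ?_, ?_, ?_, ?_,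
    ?_⟩
  · intro i j
    by_cases h : i = j <;> simp [h]
  · intro z hz
    funext i
    simpa using hz i
  · intro i hi
    simp [hi]
  · simp
  · simp

end LargeInverse

/-! ### Growth along the chain and the matrix of size `2 ^ m` -/

section Growth

variable {m : ℕ} {a₀ : Finset ℕ} {p : Finset ℕ → Finset ℕ} {F : Finset ℕ → Finset (Finset ℕ)}

/-- Along the chain the solution of the triangular system grows by a factor of about half the
size of the affine family. -/
theorem chain_growth (ha₀ : a₀ ∈ chainSets m 0)
    (hmin : ∀ s ∈ chainSets m 0, binaryRank a₀ ≤ binaryRank s)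
    (hstep : ∀ a ∈ chainSets m 0, a ≠ a₀ → IsStep m 0 a (p a) (F a))
    {X : Finset ℕ → ℝ} (hX0 : ∀ a ⊆ Finset.range m, a ∉ chainSets m 0 → X a = 0)
    (hX1 : X a₀ = 1)
    (hX : ∀ a ∈ chainSets m 0, a ≠ a₀ → ∑ s ∈ F a, X s = 2 ^ a.card / 2 * X (p a)) :
    ∀ a ∈ chainSets m 0, 0 < X a ∧
      ∑ s ∈ chainSets m 0 with binaryRank s < binaryRank a, X s ≤ X a ∧
      ∏ s ∈ chainSets m 0 with binaryRank s ≤ binaryRank a ∧ s ≠ a₀,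
        ((2 : ℝ) ^ s.card / 2 - 2) ≤ X a := by
  intro a
  induction hn : binaryRank a using Nat.strong_induction_on generalizing a with
  | _ n ih =>
  intro ha
  subst hn
  by_cases haa : a = a₀
  · subst haa
    have h1 : (chainSets m 0).filter (fun s => binaryRank s < binaryRank a) = ∅ :=
      Finset.filter_eq_empty_iff.2 fun s hs => (hmin s hs).not_gt
    have h2 : (chainSets m 0).filter (fun s => binaryRank s ≤ binaryRank a ∧ s ≠ a) = ∅ :=
      Finset.filter_eq_empty_iff.2 fun s hs h =>
        h.2 (binaryRank_injective (le_antisymm h.1 (hmin s hs)))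
    rw [h1, h2, hX1, Finset.sum_empty, Finset.prod_empty]
    exact ⟨one_pos, zero_le_one, le_rfl⟩
  have hs := hstep a ha haa
  obtain ⟨hp0, hpsum, hpprod⟩ := ih _ hs.pred_lt (p a) rfl hs.pred_mem
  have hlt : ∀ s ∈ chainSets m 0, binaryRank s < binaryRank a ↔
      s = p a ∨ binaryRank s < binaryRank (p a) := fun s hsm => by
    constructor
    · intro h
      rcases (hs.le_pred s hsm h).eq_or_lt with h | h
      · exact Or.inl (binaryRank_injective h)
      · exact Or.inr h
    · rintro (rfl | h)
      · exact hs.pred_lt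
      · exact h.trans hs.pred_lt
  have hle : ∀ s ∈ chainSets m 0, binaryRank s ≤ binaryRank a ↔
      s = a ∨ binaryRank s ≤ binaryRank (p a) := fun s hsm => by
    constructor
    · intro h
      rcases h.eq_or_lt with h | h
      · exact Or.inl (binaryRank_injective h)
      · exact Or.inr (hs.le_pred s hsm h)
    · rintro (rfl | h)
      · exact le_rfl
      · exact h.trans hs.pred_lt.le
  have hpa : p a ≠ a := fun h => by
    have := hs.pred_lt
    rw [h] at this
    exact lt_irrefl _ this
  -- The other members of the family either precede `p a` in the chain or lie off the chain, where
  -- `X` vanishes.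
  have hrest : ∑ s ∈ ((F a).erase a).erase (p a), X s ≤ X (p a) := by
    refine le_trans ?_ hpsum
    rw [← Finset.sum_filter_add_sum_filter_not _ (· ∈ chainSets m 0),
      Finset.sum_eq_zero (s := (((F a).erase a).erase (p a)).filter (· ∉ chainSets m 0)), add_zero]
    · refine Finset.sum_le_sum_of_subset_of_nonneg ?_ ?_
      · intro s hsF
        simp only [Finset.mem_filter, Finset.mem_erase] at hsF ⊢
        obtain ⟨⟨h1, h2, h3⟩, h4⟩ := hsF
        refine ⟨h4, ?_⟩
        have h5 := (hs.family_le s h3 h4).lt_of_ne fun h => h2 (binaryRank_injective h)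
        exact ((hlt s h4).1 h5).resolve_left h1
      · intro s hsF _
        obtain ⟨h1, h2⟩ := Finset.mem_filter.1 hsF
        exact (ih _ (h2.trans hs.pred_lt) s rfl h1).1.le
    · intro s hsF
      simp only [Finset.mem_filter, Finset.mem_erase] at hsF
      exact hX0 s (hs.family_subset s hsF.1.2.2) hsF.2
  have hrec : (2 ^ a.card / 2 - 2) * X (p a) ≤ X a := by
    have h1 := hX a ha haa
    rw [← Finset.add_sum_erase _ _ hs.self_mem_family,
      ← Finset.add_sum_erase _ _ (Finset.mem_erase.2 ⟨hpa, hs.pred_mem_family⟩)] at h1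
    linarith
  -- Three elements are needed here: the growth factor is then at least `2`, so `X a` also dominates
  -- the sum of all earlier terms.
  have hcard : (8 : ℝ) ≤ 2 ^ a.card := by
    have := (mem_chainSets.1 ha).2
    calc (8 : ℝ) = 2 ^ 3 := by norm_num
      _ ≤ 2 ^ a.card := pow_le_pow_right₀ (by norm_num) (by omega)
  have htwo : 2 * X (p a) ≤ X a :=
    (mul_le_mul_of_nonneg_right (by linarith) hp0.le).trans hrec
  refine ⟨by linarith, ?_, ?_⟩
  · have h1 : (chainSets m 0).filter (fun s => binaryRank s < binaryRank a) =
        insert (p a) ((chainSets m 0).filter fun s => binaryRank s < binaryRank (p a)) := by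
      ext s
      simp only [Finset.mem_filter, Finset.mem_insert]
      constructor
      · rintro ⟨h2, h3⟩
        exact ((hlt s h2).1 h3).imp_right fun h => ⟨h2, h⟩
      · rintro (rfl | ⟨h2, h3⟩)
        · exact ⟨hs.pred_mem, hs.pred_lt⟩
        · exact ⟨h2, h3.trans hs.pred_lt⟩
    rw [h1, Finset.sum_insert (by simp)]
    linarith
  · have h1 : (chainSets m 0).filter (fun s => binaryRank s ≤ binaryRank a ∧ s ≠ a₀) =
        insert a ((chainSets m 0).filter fun s => binaryRank s ≤ binaryRank (p a) ∧ s ≠ a₀) := by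
      ext s
      simp only [Finset.mem_filter, Finset.mem_insert]
      constructor
      · rintro ⟨h2, h3, h4⟩
        exact ((hle s h2).1 h3).imp_right fun h => ⟨h2, h, h4⟩
      · rintro (rfl | ⟨h2, h3, h4⟩)
        · exact ⟨ha, le_rfl, haa⟩
        · exact ⟨h2, h3.trans hs.pred_lt.le, h4⟩
    rw [h1, Finset.prod_insert (by simp [hs.pred_lt])]
    exact (mul_le_mul_of_nonneg_left hpprod (by linarith)).trans hrec

/-- The rows, on characters, of the sign matrix attached to the chain. -/
noncomputable def chainRow (m : ℕ) (a₀ : Finset ℕ) (p : Finset ℕ → Finset ℕ) (F : Finset ℕ → Finset (Finset ℕ))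
    (a x : Finset ℕ) : ℝ :=
  if a ∈ chainSets m 0 ∧ a ≠ a₀ then
    -walsh (p a) x + 2 / 2 ^ a.card * ∑ s ∈ F a, walsh s x else walsh a x

/-- The family sum is `0` or `2 ^ |a|` times `walsh (p a) x`, so the row entry is `-walsh (p a) x`
or `-walsh (p a) x + 2 * walsh (p a) x`. -/
theorem chainRow_eq_or (hstep : ∀ a ∈ chainSets m 0, a ≠ a₀ → IsStep m 0 a (p a) (F a))
    (a x : Finset ℕ) : chainRow m a₀ p F a x = 1 ∨ chainRow m a₀ p F a x = -1 := by
  unfold chainRow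
  split_ifs with h
  · have hs := hstep a h.1 h.2
    rcases hs.sum_walsh x with h0 | h0
    · rw [h0]
      rcases walsh_eq_or (p a) x with h1 | h1 <;> rw [h1] <;> simp
    · have hval : -walsh (p a) x + 2 / 2 ^ a.card * ∑ s ∈ F a, walsh s x = walsh (p a) x := by
        rw [h0, hs.card_family]
        push_cast
        field_simp
        ring
      rw [hval]
      exact walsh_eq_or _ _
  · exact walsh_eq_or _ _

theorem sum_chainRow_mul {κ : Type*} [Fintype κ] (g : κ → Finset ℕ) (y : κ → ℝ) (a : Finset ℕ) :
    ∑ z, chainRow m a₀ p F a (g z) * y z =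
      if a ∈ chainSets m 0 ∧ a ≠ a₀ then -(∑ z, walsh (p a) (g z) * y z) +
        2 / 2 ^ a.card * ∑ s ∈ F a, ∑ z, walsh s (g z) * y z
      else ∑ z, walsh a (g z) * y z := by
  unfold chainRow
  split_ifs with h
  · rw [Finset.sum_comm, Finset.mul_sum, ← Finset.sum_neg_distrib, ← Finset.sum_add_distrib]
    refine Finset.sum_congr rfl fun z _ => ?_
    rw [← Finset.sum_mul]
    ring
  · rfl

/-- The equations are triangular in the binary order: each determines `X a` from chain members
before `a` and from vanishing off-chain terms. This gives invertibility of the sign matrix. -/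
theorem chain_eq_zero (hstep : ∀ a ∈ chainSets m 0, a ≠ a₀ → IsStep m 0 a (p a) (F a))
    {X : Finset ℕ → ℝ} (hX0 : ∀ a ⊆ Finset.range m, ¬(a ∈ chainSets m 0 ∧ a ≠ a₀) → X a = 0)
    (hX : ∀ a ∈ chainSets m 0, a ≠ a₀ → ∑ s ∈ F a, X s = 2 ^ a.card / 2 * X (p a)) :
    ∀ a ⊆ Finset.range m, X a = 0 := by
  intro a
  induction hn : binaryRank a using Nat.strong_induction_on generalizing a with
  | _ n ih =>
  intro ha
  subst hn
  by_cases hc : a ∈ chainSets m 0 ∧ a ≠ a₀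
  · have hs := hstep a hc.1 hc.2
    have h1 := hX a hc.1 hc.2
    rw [ih _ hs.pred_lt (p a) rfl (mem_chainSets.1 hs.pred_mem).1, mul_zero,
      ← Finset.add_sum_erase _ _ hs.self_mem_family, Finset.sum_eq_zero, add_zero] at h1
    · exact h1
    · intro s hsF
      obtain ⟨h2, h3⟩ := Finset.mem_erase.1 hsF
      have h4 := hs.family_subset s h3
      by_cases h5 : s ∈ chainSets m 0
      · exact ih _ ((hs.family_le s h3 h5).lt_of_ne fun h => h2 (binaryRank_injective h)) s rfl h4
      · exact hX0 s h4 fun h => h5 h.1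
  · exact hX0 a ha hc

/-- Walsh inversion, from orthogonality of the characters. -/
theorem sum_walsh_mul_transform (y : (Finset.range m).powerset → ℝ) (x : (Finset.range m).powerset) :
    ∑ a ∈ (Finset.range m).powerset, walsh a x * ∑ z : (Finset.range m).powerset, walsh a z * y z =
      2 ^ m * y x := by
  simp only [Finset.mul_sum]
  rw [Finset.sum_comm]
  have h : ∀ z : (Finset.range m).powerset,
      ∑ a ∈ (Finset.range m).powerset, walsh a x * (walsh a z * y z) =
        if x = z then 2 ^ m * y z else 0 := fun z => by
    simp only [← mul_assoc, ← Finset.sum_mul]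
    rw [sum_powerset_walsh_mul_walsh (Finset.mem_powerset.1 x.2) (Finset.mem_powerset.1 z.2),
      Finset.card_range]
    by_cases hxz : x = z
    · rw [if_pos hxz, if_pos (congrArg _ hxz)]
    · rw [if_neg hxz, if_neg fun h => hxz (Subtype.ext h), zero_mul]
  simp only [h, Finset.sum_ite_eq, Finset.mem_univ, if_true]

theorem hasLargeInverseEntry_powerset (hm : 3 ≤ m) :
    ∃ a₀ ∈ chainSets m 0, HasLargeInverseEntry (Finset.range m).powerset
      ((∏ s ∈ (chainSets m 0).erase a₀, ((2 : ℝ) ^ s.card / 2 - 2)) / 2 ^ m) := by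
  have htop : Finset.range m ∈ chainSets m 0 := mem_chainSets.2 ⟨subset_rfl, by simpa using hm⟩
  obtain ⟨a₀, ha₀, hmin⟩ := (chainSets m 0).exists_min_image binaryRank ⟨_, htop⟩
  refine ⟨a₀, ha₀, ?_⟩
  have hex : ∀ a, a ∈ chainSets m 0 → a ≠ a₀ → ∃ p F, IsStep m 0 a p F := fun a ha hne => by
    refine (exists_isStep m 0 a ha).resolve_left fun h => hne ?_
    exact binaryRank_injective (le_antisymm (h a₀ ha₀) (hmin a ha))
  choose! p F hstep using hex
  set P := (Finset.range m).powerset with hP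
  set f := chainRow m a₀ p F with hf
  have hempty : (∅ : Finset ℕ) ∉ chainSets m 0 := by simp [mem_chainSets]
  have hf0 : ∀ x, f ∅ x = 1 := fun x => by
    rw [hf, chainRow, if_neg fun h => hempty h.1, walsh_empty_left]
  have hker : ∀ z : P → ℝ, (∀ a : P, ∑ x : P, f a x * z x = 0) → z = 0 := by
    intro z hz
    have hX : ∀ a ⊆ Finset.range m, ∑ x : P, walsh a x * z x = 0 := by
      refine chain_eq_zero hstep (fun a ha hc => ?_) fun a ha hc => ?_
      · have := hz ⟨a, Finset.mem_powerset.2 ha⟩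
        rwa [hf, sum_chainRow_mul, if_neg hc] at this
      · have := hz ⟨a, Finset.mem_powerset.2 (mem_chainSets.1 ha).1⟩
        rw [hf, sum_chainRow_mul, if_pos ⟨ha, hc⟩] at this
        field_simp at this ⊢
        linarith
    funext x
    have h1 := sum_walsh_mul_transform z x
    rw [Finset.sum_eq_zero fun a ha => by rw [hX a (Finset.mem_powerset.1 ha), mul_zero]] at h1
    have h2 : (2 : ℝ) ^ m ≠ 0 := by positivity
    exact (mul_eq_zero.1 h1.symm).resolve_left h2
  let L : (P → ℝ) →ₗ[ℝ] (P → ℝ) := Matrix.mulVecLin (Matrix.of fun a x : P => f a x)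
  have hL : ∀ z a, L z a = ∑ x : P, f a x * z x := fun z a => rfl
  have hLsurj : Function.Surjective L := by
    refine LinearMap.injective_iff_surjective.1 ((injective_iff_map_eq_zero L).2 fun z hz => ?_)
    exact hker z fun a => by rw [← hL, hz]; rfl
  have ha₀P : a₀ ∈ P := Finset.mem_powerset.2 (mem_chainSets.1 ha₀).1
  obtain ⟨y, hy⟩ := hLsurj (Pi.single ⟨a₀, ha₀P⟩ 1)
  have hy1 : ∑ x : P, f a₀ x * y x = 1 := by
    rw [← hL y ⟨a₀, ha₀P⟩, hy, Pi.single_eq_same]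
  have hy0 : ∀ a : P, (a : Finset ℕ) ≠ a₀ → ∑ x : P, f a x * y x = 0 := fun a ha => by
    rw [← hL, hy, Pi.single_eq_of_ne]
    exact fun h => ha (congrArg _ h)
  have hemptyP : (∅ : Finset ℕ) ∈ P := Finset.empty_mem_powerset _
  have hne0 : ∅ ≠ a₀ := fun h => hempty (h ▸ ha₀)
  have hgrow := chain_growth ha₀ hmin hstep (X := fun a => ∑ x : P, walsh a x * y x)
    (fun a ha hc => by
      have := hy0 ⟨a, Finset.mem_powerset.2 ha⟩ fun h => hc (by rw [show a = a₀ from h]; exact ha₀)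
      rwa [hf, sum_chainRow_mul, if_neg fun h => hc h.1] at this)
    (by rwa [hf, sum_chainRow_mul, if_neg fun h => h.2 rfl] at hy1)
    (fun a ha hc => by
      have := hy0 ⟨a, Finset.mem_powerset.2 (mem_chainSets.1 ha).1⟩ hc
      rw [hf, sum_chainRow_mul, if_pos ⟨ha, hc⟩] at this
      field_simp at this ⊢
      linarith)
  -- At `∅` every character is `1`, so inversion makes `2 ^ m * y ∅` the sum of all transform
  -- values; they are nonnegative, and the one at `range m` is the full product.
  have hyempty : (∏ s ∈ (chainSets m 0).erase a₀, ((2 : ℝ) ^ s.card / 2 - 2)) / 2 ^ m ≤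
      y ⟨∅, hemptyP⟩ := by
    have h1 := sum_walsh_mul_transform y ⟨∅, hemptyP⟩
    simp only [walsh_empty_right, one_mul] at h1
    rw [div_le_iff₀ (by positivity), mul_comm, ← h1]
    have h2 := (hgrow _ htop).2.2
    have h3 : (chainSets m 0).filter (fun s => binaryRank s ≤ binaryRank (Finset.range m) ∧
        s ≠ a₀) = (chainSets m 0).erase a₀ := by
      ext s
      simp only [Finset.mem_filter, Finset.mem_erase]
      exact ⟨fun h => ⟨h.2.2, h.1⟩,
        fun h => ⟨h.2, binaryRank_mono (mem_chainSets.1 h.2).1, h.1⟩⟩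
    rw [h3] at h2
    refine h2.trans (Finset.single_le_sum (f := fun a => ∑ x : P, walsh a x * y x) ?_
      (Finset.mem_powerset_self _))
    intro a ha
    by_cases hc : a ∈ chainSets m 0
    · exact (hgrow a hc).1.le
    · have := hy0 ⟨a, ha⟩ fun h => hc (by rw [show a = a₀ from h]; exact ha₀)
      rw [hf, sum_chainRow_mul, if_neg fun h => hc h.1] at this
      exact this.ge
  have hM : ∀ (a : P) (w : P → ℝ),
      ∑ x : P, (if (a : Finset ℕ) = ∅ then 1 else (1 - f a x) / 2) * w x =
        if (a : Finset ℕ) = ∅ then ∑ x, w x else (∑ x, w x - ∑ x : P, f a x * w x) / 2 := by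
    intro a w
    split_ifs
    · simp only [one_mul]
    · rw [← Finset.sum_sub_distrib, Finset.sum_div]
      exact Finset.sum_congr rfl fun x _ => by ring
  have hsum0 : ∑ x, y x = 0 := by
    have := hy0 ⟨∅, hemptyP⟩ hne0
    simpa only [hf0, one_mul] using this
  have hscale : ∀ g : P → ℝ, ∑ x, g x * (-2 * y x) = -2 * ∑ x, g x * y x := fun g => by
    rw [Finset.mul_sum]
    exact Finset.sum_congr rfl fun x _ => by ring
  have hscale' : ∑ x, -2 * y x = 0 := by rw [← Finset.mul_sum, hsum0, mul_zero]
  -- The row of `∅` is constantly `1`; every other sign row `f` becomes `(1 - f) / 2`. Since `a₀ ≠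
  -- ∅`, the entries of `y` sum to zero, and `-2 * y` solves the new system.
  refine ⟨fun a x => if (a : Finset ℕ) = ∅ then 1 else (1 - f a x) / 2, fun x => -2 * y x,
    ⟨a₀, ha₀P⟩, ⟨∅, hemptyP⟩, ?_, ?_, ?_, ?_, ?_⟩
  · intro a x
    by_cases ha : (a : Finset ℕ) = ∅
    · exact Or.inr (if_pos ha)
    · simp only [if_neg ha]
      rcases chainRow_eq_or hstep a x with h | h
      · left; rw [hf, h]; norm_num
      · right; rw [hf, h]; norm_num
  · intro z hz
    simp only [hM] at hz
    have hz0 : ∑ x, z x = 0 := by simpa using hz ⟨∅, hemptyP⟩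
    refine hker z fun a => ?_
    have h1 := hz a
    by_cases ha : (a : Finset ℕ) = ∅
    · simp only [ha, hf0, one_mul, hz0]
    · rw [if_neg ha, hz0] at h1
      linarith
  · intro a ha
    rw [hM, hscale, hscale', hy0 a fun h => ha (Subtype.ext h)]
    simp
  · rw [hM, if_neg hne0.symm, hscale, hscale', hy1]
    norm_num
  · have hnonneg : 0 ≤ y ⟨∅, hemptyP⟩ := by
      refine le_trans (div_nonneg (Finset.prod_nonneg fun s hs => ?_) (by positivity)) hyempty
      have h3 := (mem_chainSets.1 (Finset.mem_of_mem_erase hs)).2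
      have h4 : (2 : ℝ) ^ 3 ≤ 2 ^ s.card := pow_le_pow_right₀ (by norm_num) (by omega)
      linarith
    rw [abs_mul, abs_of_nonneg hnonneg]
    norm_num
    linarith

end Growth

/-! ### Size of the entries and passage to arbitrary dimension -/

section Estimates

theorem two_rpow_le_half_sub_two {k : ℕ} (hk : 3 ≤ k) :
    (2 : ℝ) ^ ((k : ℝ) - 1 - 16 * (1 / 2) ^ k) ≤ 2 ^ k / 2 - 2 := by
  have h8 : (8 : ℝ) ≤ 2 ^ k := by
    calc (8 : ℝ) = 2 ^ 3 := by norm_num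
      _ ≤ 2 ^ k := pow_le_pow_right₀ (by norm_num) hk
  set t : ℝ := 4 * (1 / 2) ^ k with ht
  have htk : t * 2 ^ k = 4 := by
    rw [ht, mul_assoc, ← mul_pow]; norm_num
  have ht0 : 0 < t := by positivity
  have ht1 : t ≤ 1 / 2 := by nlinarith
  have hlog : -4 * t * Real.log 2 ≤ Real.log (1 - t) := by
    have h1 := Real.one_sub_inv_le_log_of_pos (by linarith : 0 < 1 - t)
    have h2 : (1 - t)⁻¹ ≤ 1 + 2 * t := by
      rw [inv_le_iff_one_le_mul₀ (by linarith)]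
      nlinarith
    have h3 := Real.log_two_gt_d9
    nlinarith
  have h4 : (2 : ℝ) ^ (-4 * t) ≤ 1 - t := by
    rw [Real.rpow_def_of_pos two_pos, ← Real.le_log_iff_exp_le (by linarith)]
    linarith
  have h5 : (k : ℝ) - 1 - 16 * (1 / 2) ^ k = k - 1 + -4 * t := by rw [ht]; ring
  rw [h5, Real.rpow_add two_pos, Real.rpow_sub two_pos, Real.rpow_natCast, Real.rpow_one]
  calc (2 : ℝ) ^ k / 2 * 2 ^ (-4 * t) ≤ 2 ^ k / 2 * (1 - t) := by gcongr
    _ = 2 ^ k / 2 - t * 2 ^ k / 2 := by ring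
    _ = _ := by rw [htk]; norm_num

theorem sum_powerset_range_card (m : ℕ) :
    ∑ s ∈ (Finset.range m).powerset, (s.card : ℝ) = m * 2 ^ m / 2 := by
  induction m with
  | zero => simp
  | succ m ih =>
    have hm : m ∉ Finset.range m := Finset.notMem_range_self
    have h : ∀ s ∈ (Finset.range m).powerset, ((insert m s).card : ℝ) = s.card + 1 := fun s hs => by
      rw [Finset.card_insert_of_notMem (notMem_of_subset_range (Finset.mem_powerset.1 hs))]
      push_cast; rfl
    rw [Finset.range_add_one, Finset.sum_powerset_insert hm, Finset.sum_congr rfl h,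
      Finset.sum_add_distrib, ih]
    simp only [Finset.sum_const, Finset.card_powerset, Finset.card_range, nsmul_eq_mul]
    push_cast
    ring

theorem sum_powerset_range_half_pow (m : ℕ) :
    ∑ s ∈ (Finset.range m).powerset, (1 / 2 : ℝ) ^ s.card = (3 / 2) ^ m := by
  have h := Finset.sum_pow_mul_eq_add_pow (1 / 2 : ℝ) 1 (Finset.range m)
  simp only [one_pow, mul_one, Finset.card_range] at h
  rw [h]; norm_num

theorem natCast_le_two_mul_pow (m : ℕ) : (m : ℝ) ≤ 2 * (3 / 2) ^ m := by
  have := one_add_mul_le_pow (a := (1 / 2 : ℝ)) (by norm_num) m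
  norm_num at this
  linarith

theorem hasLargeInverseEntry_two_pow (m : ℕ) :
    HasLargeInverseEntry (Fin (2 ^ m))
      (2 ^ ((m : ℝ) * 2 ^ m / 2 - 2 ^ m - 20 * (3 / 2) ^ m) : ℝ) := by
  have hmle := natCast_le_two_mul_pow m
  have hpow0 : (0 : ℝ) < (3 / 2) ^ m := by positivity
  rcases lt_or_ge m 3 with hm | hm
  · refine (hasLargeInverseEntry_one _).mono (Real.rpow_le_one_of_one_le_of_nonpos one_le_two ?_)
    interval_cases m <;> norm_num
  · obtain ⟨a₀, ha₀, h⟩ := hasLargeInverseEntry_powerset hm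
    have hcard : Fintype.card (Finset.range m).powerset = 2 ^ m := by simp
    refine (h.congr (Fintype.equivFinOfCardEq hcard)).mono ?_
    -- The exponent of the lower bound for one factor. It is nonpositive on sets with fewer than
    -- three elements, so summing over all subsets only weakens the bound.
    let g : Finset ℕ → ℝ := fun s => (s.card : ℝ) - 1 - 16 * (1 / 2) ^ s.card
    have hsmall : ∀ s : Finset ℕ, ¬3 ≤ s.card → g s ≤ 0 := fun s hs => by
      simp only [g]
      have : s.card < 3 := by omega
      interval_cases s.card <;> norm_num
    have ha₀m : g a₀ ≤ m := by
      have h1 := Finset.card_le_card (mem_chainSets.1 ha₀).1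
      rw [Finset.card_range] at h1
      have h2 : (a₀.card : ℝ) ≤ m := by exact_mod_cast h1
      have h3 : (0 : ℝ) < (1 / 2) ^ a₀.card := by positivity
      simp only [g]
      linarith
    have hsum : ∑ s ∈ (Finset.range m).powerset, g s = m * 2 ^ m / 2 - 2 ^ m - 16 * (3 / 2) ^ m := by
      simp only [g, Finset.sum_sub_distrib, ← Finset.mul_sum, sum_powerset_range_card,
        sum_powerset_range_half_pow]
      simp
    have hle : ∑ s ∈ (Finset.range m).powerset, g s ≤ ∑ s ∈ (chainSets m 0).erase a₀, g s + m := by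
      have h1 : ∑ s ∈ (Finset.range m).powerset, g s ≤ ∑ s ∈ chainSets m 0, g s := by
        rw [chainSets, ← Finset.sum_filter_add_sum_filter_not _ fun s => 3 ≤ s.card + 0]
        have := Finset.sum_nonpos (s := (Finset.range m).powerset.filter fun s => ¬3 ≤ s.card + 0)
          (f := g) fun s hs => hsmall s (Finset.mem_filter.1 hs).2
        linarith
      rw [← Finset.add_sum_erase _ _ ha₀] at h1
      linarith
    have hprod : (2 : ℝ) ^ (∑ s ∈ (chainSets m 0).erase a₀, g s) ≤
        ∏ s ∈ (chainSets m 0).erase a₀, ((2 : ℝ) ^ s.card / 2 - 2) := by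
      rw [Real.rpow_sum_of_pos two_pos]
      refine Finset.prod_le_prod (fun s _ => by positivity) fun s hs => ?_
      exact two_rpow_le_half_sub_two (mem_chainSets.1 (Finset.mem_of_mem_erase hs)).2
    -- Dropping `a₀` and dividing by `2 ^ m` each cost `m ≤ 2 * (3 / 2) ^ m` in the exponent, which
    -- raises the constant from `16` to `20`.
    rw [le_div_iff₀ (by positivity), ← Real.rpow_natCast 2 m, ← Real.rpow_add two_pos]
    refine le_trans (Real.rpow_le_rpow_of_exponent_le one_le_two ?_) hprod
    rw [Real.rpow_natCast]
    linarith

/-- The exponent `(d / 2) log₂ d - 2 d`. -/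
noncomputable def sizeExponent (d : ℝ) : ℝ := d * Real.logb 2 d / 2 - 2 * d

/-- Midpoint convexity of `t * log t` costs `(x + y) / 2` when the sizes are merged. The linear
terms absorb it exactly because `y ≤ x`, and this is where the coefficient `2` in `sizeExponent` is
used. -/
theorem sizeExponent_add_le {x y : ℝ} (hx : 0 < x) (hy : 0 < y) (hyx : y ≤ x) :
    sizeExponent (x + y) ≤ (x * Real.logb 2 x / 2 - x) + sizeExponent y := by
  have hconv := Real.convexOn_mul_log.2 (Set.mem_Ici.2 hx.le) (Set.mem_Ici.2 hy.le)
    (by norm_num : (0 : ℝ) ≤ 1 / 2) (by norm_num : (0 : ℝ) ≤ 1 / 2) (by norm_num)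
  simp only [smul_eq_mul] at hconv
  have h1 : 1 / 2 * x + 1 / 2 * y = (x + y) / 2 := by ring
  rw [h1, Real.log_div (by linarith) two_ne_zero] at hconv
  have hl : 0 < Real.log 2 := Real.log_pos one_lt_two
  have h2 : (x + y) * Real.logb 2 (x + y) - (x + y) ≤ x * Real.logb 2 x + y * Real.logb 2 y := by
    simp only [Real.logb]
    rw [← sub_nonneg]
    have : x * (Real.log x / Real.log 2) + y * (Real.log y / Real.log 2) -
        ((x + y) * (Real.log (x + y) / Real.log 2) - (x + y)) =
        2 / Real.log 2 * (1 / 2 * (x * Real.log x) + 1 / 2 * (y * Real.log y) -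
          (x + y) / 2 * (Real.log (x + y) - Real.log 2)) := by
      field_simp
    rw [this]
    exact mul_nonneg (by positivity) (by linarith)
  unfold sizeExponent
  linarith

/-- Split off the leading binary digit of `d` and glue. The errors close up because `20 + 40 = 40 *
(3 / 2)`. -/
theorem hasLargeInverseEntry_of_lt_two_pow (m : ℕ) : ∀ d : ℕ, 1 ≤ d → d < 2 ^ m →
    HasLargeInverseEntry (Fin d) (2 ^ (sizeExponent d - 40 * (3 / 2) ^ m) : ℝ) := by
  induction m with
  | zero => intro d h1 h2; simp at h2; omega
  | succ m ih =>
    intro d h1 h2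
    have hpow0 : (0 : ℝ) < (3 / 2) ^ m := by positivity
    have hsucc : (3 / 2 : ℝ) ^ (m + 1) = (3 / 2) ^ m * (3 / 2) := pow_succ _ _
    rcases lt_or_ge d (2 ^ m) with hd | hd
    · refine (ih d h1 hd).mono (Real.rpow_le_rpow_of_exponent_le one_le_two ?_)
      rw [hsucc]; linarith
    obtain ⟨r, rfl⟩ := Nat.exists_eq_add_of_le hd
    have hlogb : Real.logb 2 ((2 : ℝ) ^ m) = m := by
      rw [← Real.rpow_natCast, Real.logb_rpow two_pos (by norm_num)]
    have h2m : (0 : ℝ) < 2 ^ m := by positivity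
    rcases Nat.eq_zero_or_pos r with rfl | hr
    · refine (hasLargeInverseEntry_two_pow m).mono (Real.rpow_le_rpow_of_exponent_le one_le_two ?_)
      rw [hsucc, sizeExponent]
      push_cast
      rw [add_zero, hlogb]
      linarith
    · have hr2 : r < 2 ^ m := by rw [pow_succ] at h2; omega
      refine (((hasLargeInverseEntry_two_pow m).sum (by positivity) (ih r hr hr2)).congr
        finSumFinEquiv).mono ?_
      rw [← Real.rpow_add two_pos]
      refine Real.rpow_le_rpow_of_exponent_le one_le_two ?_
      have h3 := sizeExponent_add_le h2m (by exact_mod_cast hr : (0 : ℝ) < r)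
        (by exact_mod_cast hr2.le)
      rw [hlogb] at h3
      rw [hsucc]
      push_cast
      linarith

end Estimates

/-! ### From the matrix to the simplex -/

section ZeroOneSimplex

variable {d : ℕ}

/-- Since `M y` is the unit vector `u` of coordinate `t`, moving along `u` changes the barycentric
coordinate of column `s` at rate `y s`. Moving from that column by `-(y s)⁻¹ • u` therefore reaches
the hyperplane of the opposite facet. -/
theorem exists_zeroOne_simplex {c : ℝ} (hd : 1 ≤ d) (hc : 0 < c)
    (h : HasLargeInverseEntry (Fin d) c) :
    ∃ σ : Affine.Simplex ℝ (EuclideanSpace ℝ (Fin d)) d,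
      (∀ i j, σ.points i j = 0 ∨ σ.points i j = 1) ∧
      ∃ b : AffineBasis (Fin (d + 1)) ℝ (EuclideanSpace ℝ (Fin d)), ⇑b = σ.points ∧
        vertexFacetDist (convexHull ℝ (Set.range b)) ≤ ((1 / c : ℝ) : EReal) := by
  obtain ⟨M, y, t, s, h01, hker, h0, h1, hys⟩ := h
  let col : Fin d → EuclideanSpace ℝ (Fin d) := fun j => WithLp.toLp 2 fun i => M i j
  have hcol : ∀ (z : Fin d → ℝ) (i : Fin d), (∑ j, z j • col j) i = ∑ j, M i j * z j := by
    intro z i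
    simp [col, mul_comm]
  have hlin : LinearIndependent ℝ col := by
    rw [Fintype.linearIndependent_iff]
    intro z hz
    have : z = 0 := hker z fun i => by rw [← hcol, hz]; rfl
    exact fun i => congrFun this i
  let v : Fin (d + 1) → EuclideanSpace ℝ (Fin d) := Fin.cons 0 col
  have hind : AffineIndependent ℝ v := by
    rw [affineIndependent_iff_linearIndependent_vsub ℝ v 0,
      ← linearIndependent_equiv (finSuccAboveEquiv (0 : Fin (d + 1)))]
    convert! hlin using 1
    funext j
    simp [v, finSuccAboveEquiv_apply]
  have htop : affineSpan ℝ (Set.range v) = ⊤ := by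
    rw [hind.affineSpan_eq_top_iff_card_eq_finrank_add_one]
    simp
  let b : AffineBasis (Fin (d + 1)) ℝ (EuclideanSpace ℝ (Fin d)) := ⟨v, hind, htop⟩
  refine ⟨⟨v, hind⟩, ?_, b, rfl, ?_⟩
  · intro i j
    refine Fin.cases ?_ (fun i => ?_) i
    · exact Or.inl rfl
    · exact h01 j i
  · have hb0 : b 0 = 0 := rfl
    have hbs : ∀ j : Fin d, b j.succ = col j := fun j => rfl
    let u : EuclideanSpace ℝ (Fin d) := EuclideanSpace.single t 1
    have hu : ∑ j, y j • col j = u := by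
      ext i
      rw [hcol]
      by_cases hi : i = t
      · rw [hi, h1]; simp [u]
      · rw [h0 i hi]; simp [u, hi]
    have hys0 : y s ≠ 0 := fun h => by
      rw [h, abs_zero] at hys
      linarith
    have hlinu : (b.coord s.succ).linear u = y s := by
      have h2 : ∀ j, (b.coord s.succ).linear (col j) = if j = s then 1 else 0 := fun j => by
        rw [← sub_zero (col j), ← hb0, ← hbs, coord_linear_sub, b.coord_apply, b.coord_apply]
        simp [Fin.succ_ne_zero, eq_comm]
      rw [← hu, map_sum]
      simp only [map_smul, h2]
      simp
    have hp : b.coord s.succ (b s.succ - (y s)⁻¹ • u) = 0 := by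
      have h3 := coord_linear_sub b s.succ (b s.succ) (b s.succ - (y s)⁻¹ • u)
      rw [sub_sub_cancel, map_smul, hlinu, b.coord_apply_eq, smul_eq_mul, inv_mul_cancel₀ hys0] at h3
      linarith
    refine (vertexFacetDist_le_dist b s.succ (by simp; omega) hp).trans ?_
    rw [EReal.coe_le_coe_iff, dist_comm, dist_eq_norm, sub_sub_cancel, norm_smul, norm_inv,
      Real.norm_eq_abs, PiLp.norm_single, norm_one, mul_one, ← one_div]
    exact one_div_le_one_div_of_le hc hys

end ZeroOneSimplex

/-- An error term for the exponent. -/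
noncomputable def exponentError (d : ℕ) : ℝ := 60 * (3 / 4) ^ Nat.log 2 d

theorem tendsto_exponentError : Tendsto exponentError atTop (𝓝 0) := by
  have hlog : Tendsto (Nat.log 2) atTop atTop := by
    refine tendsto_atTop_atTop.2 fun k => ⟨2 ^ k, fun d hd => ?_⟩
    exact (Nat.le_log_iff_pow_le one_lt_two ((Nat.two_pow_pos k).trans_le hd).ne').2 hd
  have h := (tendsto_pow_atTop_nhds_zero_of_lt_one (r := (3 / 4 : ℝ)) (by norm_num)
    (by norm_num)).comp hlog
  have h' := h.const_mul 60
  rw [mul_zero] at h'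
  exact h'

theorem one_div_two_rpow_sizeExponent_le {d : ℕ} (hd : 1 ≤ d) :
    1 / (2 : ℝ) ^ (sizeExponent d - 40 * (3 / 2) ^ (Nat.log 2 d + 1)) ≤
      (2 : ℝ) ^ ((d : ℝ) * (2 + exponentError d)) / (d : ℝ) ^ ((d : ℝ) / 2) := by
  have hd0 : (0 : ℝ) < d := by exact_mod_cast hd
  have hdd : (d : ℝ) ^ ((d : ℝ) / 2) = 2 ^ (d * Real.logb 2 d / 2) := by
    conv_lhs => rw [← Real.rpow_logb two_pos (by norm_num) hd0]
    rw [← Real.rpow_mul two_pos.le, Real.rpow_logb two_pos (by norm_num) hd0]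
    congr 1; ring
  rw [hdd, ← Real.rpow_sub two_pos, one_div, ← Real.rpow_neg two_pos.le]
  refine Real.rpow_le_rpow_of_exponent_le one_le_two ?_
  have hlog : ((2 : ℝ) ^ Nat.log 2 d) ≤ d := by
    exact_mod_cast Nat.pow_log_le_self 2 (by omega : d ≠ 0)
  -- The accumulated error `40 * (3 / 2) ^ (Nat.log 2 d + 1)` equals this left side; writing `3 / 2
  -- = 2 * (3 / 4)` and bounding `2 ^ Nat.log 2 d` by `d` shows it to be `o(d)`.
  have h1 : 60 * (3 / 2 : ℝ) ^ Nat.log 2 d ≤ d * exponentError d := by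
    have h2 : (3 / 2 : ℝ) ^ Nat.log 2 d = 2 ^ Nat.log 2 d * (3 / 4) ^ Nat.log 2 d := by
      rw [← mul_pow]; norm_num
    rw [exponentError, h2]
    have h3 : (0 : ℝ) < (3 / 4) ^ Nat.log 2 d := by positivity
    nlinarith [mul_le_mul_of_nonneg_right hlog h3.le]
  rw [pow_succ, sizeExponent]
  linarith

end PolytopeConditioning

theorem mainTheorem7 :
    ∃ ε : ℕ → ℝ, Tendsto ε atTop (𝓝 0) ∧
      ∀ d : ℕ, 1 ≤ d →
        ∃ σ : Affine.Simplex ℝ (EuclideanSpace ℝ (Fin d)) d,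
          (∀ i j, σ.points i j = 0 ∨ σ.points i j = 1) ∧
          ∃ S : Set (EuclideanSpace ℝ (Fin d)),
            S = convexHull ℝ (Set.range σ.points) ∧
            vertices S = Set.range σ.points ∧
            width (vertices S) = minWidth (vertices S) ∧
            minWidth (vertices S) ≤ pyramidalWidth (vertices S) ∧
            pyramidalWidth (vertices S) = facialDist S ∧
            facialDist S ≤ vertexFacetDist S ∧
            vertexFacetDist S ≤
              (((2 : ℝ) ^ ((d : ℝ) * (2 + ε d)) / (d : ℝ) ^ ((d : ℝ) / 2) : ℝ) : EReal) := by
  refine ⟨exponentError, tendsto_exponentError, fun d hd => ?_⟩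
  obtain ⟨σ, h01, b, hb, hvf⟩ := exists_zeroOne_simplex hd (by positivity)
    (hasLargeInverseEntry_of_lt_two_pow (Nat.log 2 d + 1) d hd
      (Nat.lt_pow_succ_log_self one_lt_two d))
  have hpyr : pyramidalWidth (Set.range b) = facialDist (convexHull ℝ (Set.range b)) :=
    le_antisymm (pyramidalWidth_le_facialDist b) (facialDist_le_pyramidalWidth b)
  refine ⟨σ, h01, convexHull ℝ (Set.range b), by rw [hb], by rw [vertices_convexHull_range, hb], ?_⟩
  rw [vertices_convexHull_range]
  refine ⟨width_eq_minWidth b, ?_, hpyr, facialDist_le_vertexFacetDist b, hvf.trans ?_⟩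
  · rw [hpyr]
    exact minWidth_le_facialDist b
  · exact EReal.coe_le_coe_iff.2 (one_div_two_rpow_sizeExponent_le hd)
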